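/- There exist a constant $c > 0$ and an integer $N$ such that the following holds for every even integer $n \ge N$. Let $\mathcal{Q}_n$ be the set of all $n \times n$ matrices with entries in $\{0,1\}$ each of whose rows sums to $n/2$, and let $Q_n$ be a uniformly random element of $\mathcal{Q}_n$. Then $$\Pr(Q_n \text{ is singular over } \mathbb{R}) \le \exp(-n^c).$$ -/

import Mathlib

/-- The product `σ`-algebra on square real matrices. -/
instance matrixMeasurableSpace (n : ℕ) : MeasurableSpace (Matrix (Fin n) (Fin n) ℝ) :=
  inferInstanceAs (MeasurableSpace (Fin n → Fin n → ℝ))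

/-- Singletons are measurable, so the uniform measure on a finite set of matrices is the
normalised counting measure. -/
instance matrixMeasurableSingletonClass (n : ℕ) :
    MeasurableSingletonClass (Matrix (Fin n) (Fin n) ℝ) :=
  inferInstanceAs (MeasurableSingletonClass (Fin n → Fin n → ℝ))

/-- The set of `n × n` matrices with entries in `{0, 1}` (viewed as real matrices) each of whose
rows sums to `n / 2` (division of real numbers, so the set is empty for odd `n`). -/
def rowRegularMatrices (n : ℕ) : Set (Matrix (Fin n) (Fin n) ℝ) :=
  {M | (∀ i j, M i j = 0 ∨ M i j = 1) ∧ ∀ i, ∑ j, M i j = (n : ℝ) / 2}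

/-!
A singular real `{0, 1}`-matrix is singular modulo every prime `p`, and `p` is taken of size about
`2 ^ w` with `w ≈ n ^ (1 / 4)`. A singular matrix has a row in the span of the others, and then
every vector `v ≠ 0` orthogonal to the other rows is orthogonal to this row too. Let `atomProb v` be the
probability that a random row is orthogonal to `v`. If `atomProb v` is of order at most `2 ^ (-w)`,
independence of the rows finishes the proof, so the matter is to bound
`∑ v, atomProb v ^ (n - 1)` over the nonzero `v` with larger `atomProb v` (`card_singular_le`).

* Vectors taking one value on all but `O(w)` coordinates are few (`card_nearlyConstant_le`). Constant
  nonzero vectors are orthogonal to no row, as `n < p`, and all others have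
  `atomProb v ≤ 143 / 144` (`atomProb_le_of_ne`).
* For the others, the argument follows Kahn–Komlós–Szemerédi and Tao–Vu. Reveal a random row two
  coordinates at a time, along a matching of at most `n / 8` pairs. Whatever was revealed before, a
  pair separates with probability at least `1 / 8`, which bounds the characteristic function of the
  row by a product over the matching (`norm_sliceSum_le_prod`). Comparing the level sets of the
  exponent by the Cauchy–Davenport inequality, as in Halász's method, shows that `atomProb v` is
  at most `4 / k` times the probability that a very lazy random walk on the differences of `v` along
  the matching returns to `0` (`atomProb_le_lazyProb`), with `k` a large constant. The expected number
  of vectors in the kernel of a square matrix of lazy random signs is only exponential in its size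
  (`sum_lazyProb_pow_univ_le`): Odlyzko's bound shows that rows rarely fail to be independent before
  the corank is very small. The factors `4 / k` beat this.
* One matching sees only few degrees of freedom of `v`. The edges of a path through nearly all
  coordinates split into eight matchings of the allowed size; the rows are split into eight
  blocks, each compared with its own matching, and `v` is determined by its differences along the
  path together with a bounded number of coordinates (`sum_wellSpread_le`). The comparison needs many
  nonzero differences along each matching, which is arranged by permuting the coordinates
  (`sum_le_sum_wellSpread`).
-/

/-! ### Characteristic functions of the uniform distribution on a slice -/

/-- The `k`-th elementary symmetric polynomial of the numbers `z i`, `i ∈ S`. When `z i` is the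
value at `v i` of a character, this is the (unnormalised) characteristic function of
`∑ i ∈ A, v i` for a uniformly random `k`-subset `A` of `S`. -/
noncomputable def sliceSum {ι : Type*} (z : ι → ℂ) (S : Finset ι) (k : ℕ) : ℂ :=
  ∑ A ∈ S.powersetCard k, ∏ i ∈ A, z i

/-- Conditioning on whether the random subset contains `x`. -/
theorem sliceSum_insert {ι : Type*} [DecidableEq ι] (z : ι → ℂ) (S : Finset ι) (k : ℕ) (x : ι)
    (hx : x ∉ S) :
    sliceSum z (insert x S) (k + 1) = sliceSum z S (k + 1) + z x * sliceSum z S k := by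
  unfold sliceSum
  rw [Finset.powersetCard_succ_insert hx, Finset.sum_union, Finset.sum_image, Finset.mul_sum]
  · congr 1
    refine Finset.sum_congr rfl fun A hA => ?_
    rw [Finset.prod_insert]
    exact fun h => hx ((Finset.mem_powersetCard.1 hA).1 h)
  · intro A hA B hB hAB
    have h1 : x ∉ A := fun h => hx ((Finset.mem_powersetCard.1 hA).1 h)
    have h2 : x ∉ B := fun h => hx ((Finset.mem_powersetCard.1 hB).1 h)
    rw [← Finset.erase_insert h1, ← Finset.erase_insert h2]
    exact congrArg (fun s => Finset.erase s x) hAB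
  · rw [Finset.disjoint_left]
    intro A hA hA'
    obtain ⟨B, -, rfl⟩ := Finset.mem_image.1 hA'
    exact hx ((Finset.mem_powersetCard.1 hA).1 (Finset.mem_insert_self _ _))

theorem norm_sliceSum_le {ι : Type*} (z : ι → ℂ) (hz : ∀ i, ‖z i‖ = 1) (S : Finset ι) (k : ℕ) :
    ‖sliceSum z S k‖ ≤ (S.card.choose k : ℝ) := by
  unfold sliceSum
  refine (norm_sum_le _ _).trans ?_
  rw [← Finset.card_powersetCard, Finset.card_eq_sum_ones, Nat.cast_sum]
  refine Finset.sum_le_sum fun A _ => ?_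
  rw [norm_prod, Finset.prod_eq_one fun i _ => hz i]
  simp

/-- Among the `(k + 2)`-subsets of an `(M + 2)`-set, the proportion of those containing exactly one
of two given points is at least `1 / 8` if both the subset and its complement contain at least a
quarter of the points. -/
theorem choose_le_of_balanced (n M k : ℕ) (h1 : n ≤ 4 * (k + 2)) (h2 : n + 4 * k ≤ 4 * M)
    (h3 : M + 2 ≤ n) : (M + 2).choose (k + 2) ≤ 16 * M.choose (k + 1) := by
  have e1 : (M + 2) * (M + 1).choose (k + 1) = (M + 2).choose (k + 2) * (k + 2) :=
    Nat.add_one_mul_choose_eq (M + 1) (k + 1)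
  have e2 : M.choose (k + 1) * (M + 1) = (M + 1).choose (k + 1) * (M + 1 - (k + 1)) :=
    Nat.choose_mul_succ_eq M (k + 1)
  have hk : M + 1 - (k + 1) = M - k := by omega
  rw [hk] at e2
  obtain ⟨r, rfl⟩ : ∃ r, M = k + r := ⟨M - k, by omega⟩
  have hr : k + r - k = r := by omega
  rw [hr] at e2
  have e3 : (k + r + 2).choose (k + 2) * ((k + 2) * r)
      = ((k + r + 2) * (k + r + 1)) * (k + r).choose (k + 1) := by
    calc (k + r + 2).choose (k + 2) * ((k + 2) * r)
        = ((k + r + 2).choose (k + 2) * (k + 2)) * r := by ring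
      _ = (k + r + 2) * ((k + r + 1).choose (k + 1) * r) := by rw [← e1]; ring
      _ = _ := by rw [← e2]; ring
  have h4 : (k + r + 2) * (k + r + 1) ≤ 16 * ((k + 2) * r) := by nlinarith
  have hpos : 0 < (k + 2) * r := by
    have : 0 < r := by omega
    positivity
  refine Nat.le_of_mul_le_mul_right ?_ hpos
  rw [e3]
  nlinarith [Nat.zero_le ((k + r).choose (k + 1))]

/-- Revealing a random slice element one pair of coordinates at a time: as long as the part not yet
revealed stays balanced, each pair `(a j, b j)` separates with conditional probability at least
`1 / 8`, and then it contributes a factor `‖z (a j) + z (b j)‖ / 2`. -/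
theorem norm_sliceSum_le_prod {ι κ : Type*} [DecidableEq ι] [DecidableEq κ] (z : ι → ℂ)
    (hz : ∀ i, ‖z i‖ = 1) (a b : κ → ι) (hab : ∀ i j, a i ≠ b j) (ha : Function.Injective a)
    (hb : Function.Injective b) (n : ℕ) (J : Finset κ) :
    ∀ (S : Finset ι) (k : ℕ), (∀ j ∈ J, a j ∈ S ∧ b j ∈ S) → S.card ≤ n →
      n + 8 * J.card ≤ 4 * k → n + 8 * J.card + 4 * k ≤ 4 * S.card →
      ‖sliceSum z S k‖ ≤
        (S.card.choose k : ℝ) * ∏ j ∈ J, (7 / 8 + ‖z (a j) + z (b j)‖ / 2 / 8) := by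
  induction J using Finset.induction_on with
  | empty => intro S k _ _ _ _; simpa using norm_sliceSum_le z hz S k
  | insert j J hj ih =>
    intro S k hS hSn hk1 hk2
    rw [Finset.card_insert_of_notMem hj] at hk1 hk2
    rw [Finset.prod_insert hj]
    obtain ⟨k, rfl⟩ : ∃ l, k = l + 2 := ⟨k - 2, by omega⟩
    obtain ⟨haS, hbS⟩ := hS j (Finset.mem_insert_self _ _)
    set T := (S.erase (a j)).erase (b j) with hT
    have hbE : b j ∈ S.erase (a j) := Finset.mem_erase.2 ⟨(hab j j).symm, hbS⟩
    have hbT : b j ∉ T := Finset.notMem_erase _ _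
    have haT : a j ∉ insert (b j) T := by
      rw [hT, Finset.insert_erase hbE]; exact Finset.notMem_erase _ _
    have hST : S = insert (a j) (insert (b j) T) := by
      rw [hT, Finset.insert_erase hbE, Finset.insert_erase haS]
    have hcard : S.card = T.card + 2 := by
      rw [hST, Finset.card_insert_of_notMem haT, Finset.card_insert_of_notMem hbT]
    have hJT : ∀ i ∈ J, a i ∈ T ∧ b i ∈ T := by
      intro i hi
      obtain ⟨h1, h2⟩ := hS i (Finset.mem_insert_of_mem hi)
      have hij : i ≠ j := fun h => hj (h ▸ hi)
      simp only [hT, Finset.mem_erase]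
      exact ⟨⟨hab i j, ha.ne hij, h1⟩, ⟨hb.ne hij, (hab j i).symm, h2⟩⟩
    have r2 := ih T (k + 2) hJT (by omega) (by omega) (by omega)
    have r1 := ih T (k + 1) hJT (by omega) (by omega) (by omega)
    have r0 := ih T k hJT (by omega) (by omega) (by omega)
    have hch := choose_le_of_balanced n T.card k (by omega) (by omega) (by omega)
    have hexp : sliceSum z S (k + 2) = sliceSum z T (k + 2) + (z (a j) + z (b j)) * sliceSum z T (k + 1)
        + z (a j) * z (b j) * sliceSum z T k := by
      rw [hST, sliceSum_insert z _ (k + 1) _ haT, sliceSum_insert z _ (k + 1) _ hbT,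
        sliceSum_insert z _ k _ hbT]
      ring
    have hpas : (T.card + 2).choose (k + 2)
        = T.card.choose k + 2 * T.card.choose (k + 1) + T.card.choose (k + 2) := by
      rw [Nat.choose_succ_succ, Nat.choose_succ_succ, Nat.choose_succ_succ T.card (k + 1)]
      ring
    set P := ∏ j ∈ J, (7 / 8 + ‖z (a j) + z (b j)‖ / 2 / 8) with hP
    have hP0 : 0 ≤ P := Finset.prod_nonneg fun i _ => by positivity
    set c := ‖z (a j) + z (b j)‖ with hc
    have hc0 : 0 ≤ c := norm_nonneg _
    have hc2 : c ≤ 2 := by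
      have := norm_add_le (z (a j)) (z (b j))
      rw [hz, hz] at this
      linarith
    have hnorm : ‖sliceSum z S (k + 2)‖ ≤ ‖sliceSum z T (k + 2)‖ + c * ‖sliceSum z T (k + 1)‖
        + ‖sliceSum z T k‖ := by
      rw [hexp]
      refine (norm_add₃_le).trans ?_
      rw [norm_mul, norm_mul, norm_mul, hz, hz]
      linarith
    rw [hcard]
    have hpas' : ((T.card + 2).choose (k + 2) : ℝ)
        = T.card.choose k + 2 * T.card.choose (k + 1) + T.card.choose (k + 2) := by
      exact_mod_cast hpas
    have hch' : ((T.card + 2).choose (k + 2) : ℝ) ≤ 16 * T.card.choose (k + 1) := by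
      exact_mod_cast hch
    calc ‖sliceSum z S (k + 2)‖
        ≤ (T.card.choose (k + 2) : ℝ) * P + c * ((T.card.choose (k + 1) : ℝ) * P)
          + (T.card.choose k : ℝ) * P := by
          refine hnorm.trans ?_
          gcongr
      _ = ((T.card.choose k : ℝ) + c * T.card.choose (k + 1) + T.card.choose (k + 2)) * P := by ring
      _ ≤ (((T.card + 2).choose (k + 2) : ℝ) * (7 / 8 + c / 2 / 8)) * P := by
          gcongr
          nlinarith
      _ = _ := by ring

/-! ### Distances and characters modulo a prime -/

/-- The distance from `a / p` to the nearest integer. -/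
noncomputable def circDist {p : ℕ} (a : ZMod p) : ℝ := |(a.valMinAbs : ℝ)| / p

section circDist

variable {p : ℕ}

theorem circDist_nonneg (a : ZMod p) : 0 ≤ circDist a := by unfold circDist; positivity

theorem circDist_zero : circDist (0 : ZMod p) = 0 := by simp [circDist]

theorem abs_valMinAbs_div (a : ZMod p) : |((a.valMinAbs : ℝ) / p)| = circDist a := by
  rw [abs_div, Nat.abs_cast, circDist]

theorem one_sub_le_cos_two_pi_circDist (a : ZMod p) :
    1 - 20 * circDist a ^ 2 ≤ Real.cos (2 * Real.pi * circDist a) := by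
  refine le_trans ?_ Real.one_sub_sq_div_two_le_cos
  have hpi : Real.pi ^ 2 ≤ 10 := by nlinarith [Real.pi_lt_d2, Real.pi_pos]
  nlinarith [sq_nonneg (circDist a)]

variable [hp : Fact p.Prime]

theorem circDist_le_half (a : ZMod p) : circDist a ≤ 1 / 2 := by
  have hp0 : (0 : ℝ) < p := by exact_mod_cast hp.out.pos
  unfold circDist
  rw [div_le_div_iff₀ hp0 two_pos]
  have h := ZMod.natAbs_valMinAbs_le a
  have h2 : a.valMinAbs.natAbs * 2 ≤ p := by omega
  have h3 : ((a.valMinAbs.natAbs : ℕ) : ℝ) = |(a.valMinAbs : ℝ)| := by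
    rw [Nat.cast_natAbs, Int.cast_abs]
  rw [← h3, one_mul]
  exact_mod_cast h2

theorem circDist_add_le (a b : ZMod p) : circDist (a + b) ≤ circDist a + circDist b := by
  have hp0 : (0 : ℝ) < p := by exact_mod_cast hp.out.pos
  unfold circDist
  rw [← add_div]
  have h := ZMod.natAbs_valMinAbs_add_le a b
  have h1 : |((a + b).valMinAbs : ℝ)| ≤ |((a.valMinAbs + b.valMinAbs : ℤ) : ℝ)| := by
    rw [← Int.cast_abs, ← Int.cast_abs, ← Nat.cast_natAbs, ← Nat.cast_natAbs]
    exact_mod_cast h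
  gcongr
  refine h1.trans ?_
  push_cast
  exact abs_add_le _ _

theorem circDist_neg (a : ZMod p) : circDist (-a) = circDist a := by
  unfold circDist
  congr 1
  rw [← Int.cast_abs, ← Int.cast_abs, ← Nat.cast_natAbs, ← Nat.cast_natAbs,
    ZMod.natAbs_valMinAbs_neg]

theorem sum_circDist_sq (h3 : 3 ≤ p) : (p : ℝ) / 36 ≤ ∑ t : ZMod p, circDist t ^ 2 := by
  set h : ZMod p := ((p / 2 : ℕ) : ZMod p) with hh
  have hh3 : 1 / 3 ≤ circDist h := by
    have hp0 : (0 : ℝ) < p := by exact_mod_cast hp.out.pos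
    unfold circDist
    rw [hh, ZMod.valMinAbs_natCast_of_le_half le_rfl, div_le_div_iff₀ three_pos hp0]
    have : p ≤ (p / 2) * 3 := by omega
    rw [Int.cast_natCast, Nat.abs_cast, one_mul]
    exact_mod_cast this
  have hsum : ∑ t : ZMod p, circDist (t + h) ^ 2 = ∑ t : ZMod p, circDist t ^ 2 :=
    Equiv.sum_comp (Equiv.addRight h) (fun t : ZMod p => circDist t ^ 2)
  -- `t` and `t + h` cannot both be close to `0`, as `h / p` is close to `1 / 2`.
  have key : ∀ t : ZMod p, (1 : ℝ) / 18 ≤ circDist t ^ 2 + circDist (t + h) ^ 2 := by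
    intro t
    have h1 : circDist h ≤ circDist (t + h) + circDist t := by
      have := circDist_add_le (t + h) (-t)
      rw [circDist_neg] at this
      simpa using this
    nlinarith [sq_nonneg (circDist t - circDist (t + h))]
  have hle := Finset.sum_le_sum fun t (_ : t ∈ Finset.univ) => key t
  rw [Finset.sum_add_distrib, hsum, Finset.sum_const, Finset.card_univ, ZMod.card,
    nsmul_eq_mul] at hle
  linarith

theorem sum_circDist_mul_sq (h3 : 3 ≤ p) {d : ZMod p} (hd : d ≠ 0) :
    (p : ℝ) / 36 ≤ ∑ t : ZMod p, circDist (t * d) ^ 2 :=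
  (sum_circDist_sq h3).trans_eq
    (Equiv.sum_comp (Equiv.mulRight₀ d hd) (fun t : ZMod p => circDist t ^ 2)).symm

theorem stdAddChar_eq_exp (a : ZMod p) :
    ZMod.stdAddChar a = Complex.exp ((2 * Real.pi * (a.valMinAbs / p) : ℝ) * Complex.I) := by
  conv_lhs => rw [← ZMod.coe_valMinAbs a, ZMod.stdAddChar_coe]
  congr 1
  push_cast
  ring

theorem norm_stdAddChar (a : ZMod p) : ‖(ZMod.stdAddChar a : ℂ)‖ = 1 := by
  rw [stdAddChar_eq_exp, Complex.norm_exp_ofReal_mul_I]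

theorem re_stdAddChar (a : ZMod p) :
    (ZMod.stdAddChar a : ℂ).re = Real.cos (2 * Real.pi * circDist a) := by
  rw [stdAddChar_eq_exp, Complex.exp_ofReal_mul_I_re, ← abs_valMinAbs_div, ← Real.cos_abs,
    abs_mul, abs_of_pos Real.two_pi_pos]

theorem stdAddChar_add_neg (a : ZMod p) :
    (ZMod.stdAddChar a : ℂ) + ZMod.stdAddChar (-a)
      = ((2 * Real.cos (2 * Real.pi * circDist a) : ℝ) : ℂ) := by
  have h : (ZMod.stdAddChar (-a) : ℂ) = (starRingEnd ℂ) (ZMod.stdAddChar a) := by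
    rw [AddChar.map_neg_eq_inv, Complex.inv_def, Complex.normSq_eq_norm_sq, norm_stdAddChar]
    simp
  rw [h, Complex.add_conj, re_stdAddChar]

theorem norm_stdAddChar_add (a b : ZMod p) :
    ‖(ZMod.stdAddChar a : ℂ) + ZMod.stdAddChar b‖ / 2 = Real.cos (Real.pi * circDist (b - a)) := by
  have h0 : 0 ≤ Real.cos (Real.pi * circDist (b - a)) := by
    refine Real.cos_nonneg_of_mem_Icc ⟨?_, ?_⟩
    · have := circDist_nonneg (b - a)
      nlinarith [Real.pi_pos]
    · have := circDist_le_half (b - a)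
      nlinarith [Real.pi_pos]
  have hre := re_stdAddChar (b - a)
  have hn : ‖(1 : ℂ) + ZMod.stdAddChar (b - a)‖ ^ 2
      = (2 * Real.cos (Real.pi * circDist (b - a))) ^ 2 := by
    have h1 : Complex.normSq (ZMod.stdAddChar (b - a)) = 1 := by
      rw [Complex.normSq_eq_norm_sq, norm_stdAddChar, one_pow]
    rw [Complex.normSq_apply] at h1
    rw [← Complex.normSq_eq_norm_sq, Complex.normSq_apply]
    simp only [Complex.add_re, Complex.one_re, Complex.add_im, Complex.one_im, zero_add]
    rw [mul_assoc, Real.cos_two_mul] at hre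
    nlinarith
  have hmul : (ZMod.stdAddChar a : ℂ) + ZMod.stdAddChar b
      = ZMod.stdAddChar a * (1 + ZMod.stdAddChar (b - a)) := by
    rw [mul_add, mul_one, ← AddChar.map_add_eq_mul, add_sub_cancel]
  rw [hmul, norm_mul, norm_stdAddChar, one_mul]
  have := (pow_left_inj₀ (norm_nonneg _) (by positivity) two_ne_zero).1 hn
  rw [this]
  ring

theorem cos_pi_circDist_le (a : ZMod p) :
    Real.cos (Real.pi * circDist a) ≤ 1 - 2 * circDist a ^ 2 := by
  have h0 := circDist_nonneg a
  have h1 := circDist_le_half a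
  have hpi := Real.pi_pos
  have h := Real.cos_le_one_sub_mul_cos_sq (x := Real.pi * circDist a)
    (by rw [abs_of_nonneg (by positivity)]; nlinarith)
  refine h.trans_eq ?_
  field_simp

/-- The number of solutions of `F x = 0` by orthogonality of characters. -/
theorem card_filter_eq_zero {α : Type*} (s : Finset α) (F : α → ZMod p) :
    (((s.filter fun x => F x = 0).card : ℕ) : ℂ)
      = (1 / p) * ∑ t : ZMod p, ∑ x ∈ s, (ZMod.stdAddChar (t * F x) : ℂ) := by
  have hp0 : (p : ℂ) ≠ 0 := by exact_mod_cast hp.out.ne_zero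
  rw [Finset.sum_comm]
  have h : ∀ x ∈ s, ∑ t : ZMod p, (ZMod.stdAddChar (t * F x) : ℂ) = if F x = 0 then (p : ℂ) else 0 := by
    intro x _
    have := AddChar.sum_mulShift (F x) (ZMod.isPrimitive_stdAddChar p)
    rw [this, ZMod.card]
    split_ifs <;> simp
  rw [Finset.sum_congr rfl h, ← Finset.sum_filter, Finset.sum_const, nsmul_eq_mul]
  field_simp

end circDist

/-! ### Anticoncentration on the slice -/

/-- The half-size subsets `A` of `Fin n`, that is, the elements of the middle slice of the cube,
with `∑ i ∈ A, v i = 0`. -/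
def sliceZeros {n p : ℕ} (v : Fin n → ZMod p) : Finset (Finset (Fin n)) :=
  (Finset.univ.powersetCard (n / 2)).filter fun A => ∑ i ∈ A, v i = 0

/-- The probability that `∑ i ∈ A, v i = 0` for a uniformly random half-size subset `A`. -/
noncomputable def atomProb {n p : ℕ} (v : Fin n → ZMod p) : ℝ :=
  (sliceZeros v).card / (n.choose (n / 2) : ℝ)

theorem atomProb_nonneg {n p : ℕ} (v : Fin n → ZMod p) : 0 ≤ atomProb v := by
  unfold atomProb; positivity

theorem choose_half_pos (n : ℕ) : (0 : ℝ) < (n.choose (n / 2) : ℝ) := by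
  exact_mod_cast Nat.choose_pos (Nat.div_le_self n 2)

theorem card_sliceZeros {n p : ℕ} (v : Fin n → ZMod p) :
    ((sliceZeros v).card : ℝ) = atomProb v * n.choose (n / 2) := by
  unfold atomProb
  rw [div_mul_cancel₀ _ (choose_half_pos n).ne']

theorem atomProb_comp_perm {n p : ℕ} (v : Fin n → ZMod p) (σ : Equiv.Perm (Fin n)) :
    atomProb (v ∘ σ) = atomProb v := by
  unfold atomProb
  congr 2
  refine Finset.card_bij (fun A _ => A.map σ.toEmbedding) ?_ ?_ ?_
  · intro A hA
    simp only [sliceZeros, Finset.mem_filter, Finset.mem_powersetCard_univ] at hA ⊢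
    simpa using hA
  · intro A _ B _ h
    exact Finset.map_injective _ h
  · intro B hB
    simp only [sliceZeros, Finset.mem_filter, Finset.mem_powersetCard_univ] at hB
    refine ⟨B.map σ.symm.toEmbedding, ?_, ?_⟩
    · simp only [sliceZeros, Finset.mem_filter, Finset.mem_powersetCard_univ]
      simpa using hB
    · ext x
      simp

section Fourier

variable {p : ℕ} [hp : Fact p.Prime]

/-- The Fourier bound for the slice: only the differences of `v` along a matching enter. -/
theorem atomProb_le {n : ℕ} (hn : Even n) (v : Fin n → ZMod p) {κ : Type*} [Fintype κ]
    [DecidableEq κ] (a b : κ → Fin n) (hab : ∀ i j, a i ≠ b j) (ha : Function.Injective a)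
    (hb : Function.Injective b) (hκ : 8 * Fintype.card κ ≤ n) :
    atomProb v ≤ (1 / p) * ∑ t : ZMod p, ∏ j,
      (7 / 8 + Real.cos (Real.pi * circDist (t * (v (b j) - v (a j)))) / 8) := by
  obtain ⟨m, rfl⟩ := hn
  have hcount := card_filter_eq_zero (p := p)
    ((Finset.univ : Finset (Fin (m + m))).powersetCard ((m + m) / 2)) (fun A => ∑ i ∈ A, v i)
  have hterm : ∀ t : ZMod p,
      ∑ A ∈ (Finset.univ : Finset (Fin (m + m))).powersetCard ((m + m) / 2),
        (ZMod.stdAddChar (t * ∑ i ∈ A, v i) : ℂ)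
      = sliceSum (fun i => (ZMod.stdAddChar (t * v i) : ℂ)) Finset.univ ((m + m) / 2) := by
    intro t
    unfold sliceSum
    refine Finset.sum_congr rfl fun A _ => ?_
    rw [Finset.mul_sum]
    exact map_prod (ZMod.stdAddChar (N := p)).toMonoidHom (fun i => Multiplicative.ofAdd (t * v i)) A
  simp only [hterm] at hcount
  have hbound : ∀ t : ZMod p,
      ‖sliceSum (fun i => (ZMod.stdAddChar (t * v i) : ℂ)) Finset.univ ((m + m) / 2)‖ ≤
        ((m + m).choose ((m + m) / 2) : ℝ) *
          ∏ j, (7 / 8 + Real.cos (Real.pi * circDist (t * (v (b j) - v (a j)))) / 8) := by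
    intro t
    have h := norm_sliceSum_le_prod (fun i => (ZMod.stdAddChar (t * v i) : ℂ))
      (fun i => norm_stdAddChar _) a b hab ha hb (m + m) Finset.univ Finset.univ ((m + m) / 2)
      (by simp) (by simp) (by rw [Finset.card_univ]; omega)
      (by rw [Finset.card_univ, Finset.card_univ, Fintype.card_fin]; omega)
    simp only [norm_stdAddChar_add, Finset.card_univ, Fintype.card_fin, ← mul_sub] at h
    exact h
  have hnorm := congrArg norm hcount
  rw [Complex.norm_natCast, norm_mul] at hnorm
  unfold atomProb
  rw [div_le_iff₀ (choose_half_pos _)]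
  change (((Finset.univ.powersetCard ((m + m) / 2)).filter fun A => ∑ i ∈ A, v i = 0).card : ℝ) ≤ _
  rw [hnorm]
  have h1 : ‖(1 / p : ℂ)‖ = 1 / p := by simp
  rw [h1, mul_assoc, Finset.sum_mul]
  gcongr
  refine (norm_sum_le _ _).trans (Finset.sum_le_sum fun t _ => ?_)
  rw [mul_comm]
  exact hbound t

/-- The Fourier bound for a single pair of coordinates on which `v` differs. -/
theorem atomProb_le_of_ne {n : ℕ} (hn : Even n) (hn8 : 8 ≤ n) (hp3 : 3 ≤ p) (v : Fin n → ZMod p)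
    {i j : Fin n} (hij : v i ≠ v j) : atomProb v ≤ 143 / 144 := by
  have hp0 : (0 : ℝ) < p := by exact_mod_cast hp.out.pos
  have h := atomProb_le hn v (fun _ : Unit => i) (fun _ => j)
    (fun _ _ h => hij (congrArg v h)) (fun _ _ _ => rfl) (fun _ _ _ => rfl) (by simpa using hn8)
  refine h.trans ?_
  have hd : v j - v i ≠ 0 := sub_ne_zero.2 hij.symm
  have hs := sum_circDist_mul_sq hp3 hd
  have hle : ∑ t : ZMod p, ∏ _j : Unit,
      (7 / 8 + Real.cos (Real.pi * circDist (t * (v j - v i))) / 8)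
      ≤ ∑ t : ZMod p, (1 - circDist (t * (v j - v i)) ^ 2 / 4) := by
    refine Finset.sum_le_sum fun t _ => ?_
    have := cos_pi_circDist_le (t * (v j - v i))
    simp only [Finset.univ_unique, Finset.prod_const, Finset.card_singleton, pow_one]
    linarith
  rw [Finset.sum_sub_distrib, ← Finset.sum_div, Finset.sum_const, Finset.card_univ, ZMod.card,
    nsmul_eq_mul, mul_one] at hle
  rw [one_div, inv_mul_le_iff₀ hp0]
  linarith

/-- The sum of the squared distances to the integers of the numbers `t * d j / p`. -/
noncomputable def energy {h : ℕ} (d : Fin h → ZMod p) (t : ZMod p) : ℝ :=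
  ∑ j, circDist (t * d j) ^ 2

theorem energy_nonneg {h : ℕ} (d : Fin h → ZMod p) (t : ZMod p) : 0 ≤ energy d t :=
  Finset.sum_nonneg fun _ _ => sq_nonneg _

theorem energy_zero {h : ℕ} (d : Fin h → ZMod p) : energy d 0 = 0 := by
  simp [energy, circDist_zero]

/-- The square root of the energy is subadditive. -/
theorem energy_add_le {h : ℕ} (d : Fin h → ZMod p) (s t : ZMod p) (i : ℕ) (hi : 0 < i) (l : ℝ)
    (hs : energy d s ≤ l) (ht : energy d t ≤ (i : ℝ) ^ 2 * l) :
    energy d (s + t) ≤ ((i + 1 : ℕ) : ℝ) ^ 2 * l := by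
  have hi' : (0 : ℝ) < i := by exact_mod_cast hi
  have h1 : energy d (s + t) ≤ (1 + i) * energy d s + (1 + 1 / i) * energy d t := by
    unfold energy
    rw [Finset.mul_sum, Finset.mul_sum, ← Finset.sum_add_distrib]
    refine Finset.sum_le_sum fun j _ => ?_
    have h0 := circDist_add_le (s * d j) (t * d j)
    rw [← add_mul] at h0
    have h2 := circDist_nonneg ((s + t) * d j)
    set x := circDist (s * d j)
    set y := circDist (t * d j)
    have h3 : circDist ((s + t) * d j) ^ 2 ≤ (x + y) ^ 2 := by gcongr
    refine h3.trans ?_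
    have h4 : (1 + (i : ℝ)) * x ^ 2 + (1 + 1 / i) * y ^ 2 - (x + y) ^ 2
        = (i * x - y) ^ 2 / i := by field_simp; ring
    have h5 : 0 ≤ (i * x - y) ^ 2 / (i : ℝ) := by positivity
    linarith
  refine h1.trans ?_
  calc (1 + (i : ℝ)) * energy d s + (1 + 1 / i) * energy d t
      ≤ (1 + i) * l + (1 + 1 / i) * ((i : ℝ) ^ 2 * l) := by gcongr
    _ = _ := by push_cast; field_simp; ring

theorem sum_energy_ge (hp3 : 3 ≤ p) {h : ℕ} (d : Fin h → ZMod p) :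
    ((Finset.univ.filter fun j => d j ≠ 0).card : ℝ) * (p / 36) ≤ ∑ t, energy d t := by
  unfold energy
  rw [Finset.sum_comm, ← nsmul_eq_mul, ← Finset.sum_const]
  calc ∑ _j ∈ Finset.univ.filter (fun j => d j ≠ 0), (p / 36 : ℝ)
      ≤ ∑ j ∈ Finset.univ.filter (fun j => d j ≠ 0), ∑ t : ZMod p, circDist (t * d j) ^ 2 :=
        Finset.sum_le_sum fun j hj => sum_circDist_mul_sq hp3 (Finset.mem_filter.1 hj).2
    _ ≤ _ := Finset.sum_le_sum_of_subset_of_nonneg (Finset.filter_subset _ _)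
        fun _ _ _ => Finset.sum_nonneg fun _ _ => sq_nonneg _

open scoped Pointwise in
/-- Growth of the level sets of the energy, by iterating the Cauchy–Davenport inequality. -/
theorem min_le_card_level {h : ℕ} (d : Fin h → ZMod p) (l : ℝ) (hl : 0 ≤ l) (i : ℕ) (hi : 0 < i) :
    min p (i * ((Finset.univ.filter fun t => energy d t ≤ l).card - 1) + 1)
      ≤ (Finset.univ.filter fun t => energy d t ≤ (i : ℝ) ^ 2 * l).card := by
  set A := Finset.univ.filter fun t => energy d t ≤ l with hA
  have hA0 : (0 : ZMod p) ∈ A := by simp [hA, energy_zero, hl]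
  have hApos : 0 < A.card := Finset.card_pos.2 ⟨0, hA0⟩
  induction i, hi using Nat.le_induction with
  | base =>
    simp only [Nat.cast_one, one_pow, one_mul, ← hA]
    omega
  | succ i hi ih =>
    set B := Finset.univ.filter fun t => energy d t ≤ (i : ℝ) ^ 2 * l with hB
    have hB0 : (0 : ZMod p) ∈ B := by
      simp only [hB, Finset.mem_filter, Finset.mem_univ, true_and, energy_zero]; positivity
    have hcd := ZMod.cauchy_davenport hp.out ⟨0, hA0⟩ ⟨0, hB0⟩
    have hsub : A + B ⊆ Finset.univ.filter fun t => energy d t ≤ ((i + 1 : ℕ) : ℝ) ^ 2 * l := by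
      intro x hx
      obtain ⟨s, hs, t, ht, rfl⟩ := Finset.mem_add.1 hx
      simp only [hA, hB, Finset.mem_filter, Finset.mem_univ, true_and] at hs ht ⊢
      exact energy_add_le d s t i hi l hs ht
    have hle := Finset.card_le_card hsub
    have hBpos : 0 < B.card := Finset.card_pos.2 ⟨0, hB0⟩
    have e : (i + 1) * (A.card - 1) + 1 = i * (A.card - 1) + 1 + (A.card - 1) := by ring
    rw [e]
    omega

/-- The level set at height `k ^ 2 * l` is larger, roughly by a factor of at least `k`, than the one at
height `l`. When `d` has enough nonzero entries, the average energy exceeds `k ^ 2 * l`, so that the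
larger level set is not all of `ZMod p` and Cauchy–Davenport is not saturated. -/
theorem card_level_le (hp3 : 3 ≤ p) {h : ℕ} (d : Fin h → ZMod p) (k : ℕ) (hk : 0 < k) (l : ℝ)
    (hl : 0 ≤ l)
    (hunsat : 36 * (k : ℝ) ^ 2 * l < (Finset.univ.filter fun j => d j ≠ 0).card) :
    ((Finset.univ.filter fun t => energy d t ≤ l).card : ℝ)
      ≤ 1 + (Finset.univ.filter fun t => energy d t ≤ (k : ℝ) ^ 2 * l).card / k := by
  have hk' : (0 : ℝ) < k := by exact_mod_cast hk
  have hp0 : (0 : ℝ) < p := by exact_mod_cast hp.out.pos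
  have h1 := min_le_card_level d l hl k hk
  set A := Finset.univ.filter fun t => energy d t ≤ l with hA
  set B := Finset.univ.filter fun t => energy d t ≤ (k : ℝ) ^ 2 * l with hB
  have hA0 : (0 : ZMod p) ∈ A := by simp [hA, energy_zero, hl]
  have hApos : 0 < A.card := Finset.card_pos.2 ⟨0, hA0⟩
  have hlt : B.card < p := by
    by_contra! hge
    have huniv : B = Finset.univ := by
      rw [← Finset.card_eq_iff_eq_univ, ZMod.card]
      exact le_antisymm ((Finset.card_le_univ _).trans_eq (ZMod.card p)) hge
    have hall : ∑ t, energy d t ≤ ∑ _t : ZMod p, (k : ℝ) ^ 2 * l := by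
      refine Finset.sum_le_sum fun t _ => ?_
      have ht : t ∈ B := huniv ▸ Finset.mem_univ t
      simpa [hB] using ht
    rw [Finset.sum_const, Finset.card_univ, ZMod.card, nsmul_eq_mul] at hall
    have := sum_energy_ge hp3 d
    nlinarith
  have h2 : k * (A.card - 1) + 1 ≤ B.card := by
    rcases min_le_iff.1 h1 with h | h
    · omega
    · exact h
  have h3 : (k : ℝ) * ((A.card : ℝ) - 1) + 1 ≤ B.card := by
    have : ((A.card - 1 : ℕ) : ℝ) = (A.card : ℝ) - 1 := by
      rw [Nat.cast_sub hApos, Nat.cast_one]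
    rw [← this]
    exact_mod_cast h2
  have h4 : (A.card : ℝ) - 1 ≤ B.card / k := by
    rw [le_div_iff₀ hk']
    nlinarith
  linarith

end Fourier

/-- A discrete layer cake decomposition of `exp (-f / 4)` into indicators of `f ≤ j + 1`. -/
theorem exp_neg_le_sum_indicator (f : ℝ) (hf : 0 ≤ f) (J : ℕ) :
    Real.exp (-f / 4) ≤ (∑ j ∈ Finset.range J,
        (Real.exp (-(j : ℝ) / 4) - Real.exp (-((j + 1 : ℕ) : ℝ) / 4)) *
          (if f ≤ ((j + 1 : ℕ) : ℝ) then 1 else 0)) + Real.exp (-(J : ℝ) / 4) := by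
  induction J with
  | zero =>
    simp only [Finset.range_zero, Finset.sum_empty, Nat.cast_zero, neg_zero, zero_div,
      Real.exp_zero, zero_add]
    exact Real.exp_le_one_iff.2 (by linarith)
  | succ J ih =>
    rw [Finset.sum_range_succ]
    split_ifs with h
    · linarith
    · rw [mul_zero, add_zero]
      have h1 : Real.exp (-f / 4) ≤ Real.exp (-((J + 1 : ℕ) : ℝ) / 4) :=
        Real.exp_le_exp.2 (by linarith [not_le.1 h])
      have h2 : 0 ≤ ∑ j ∈ Finset.range J,
        (Real.exp (-(j : ℝ) / 4) - Real.exp (-((j + 1 : ℕ) : ℝ) / 4)) *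
          (if f ≤ ((j + 1 : ℕ) : ℝ) then (1 : ℝ) else 0) := by
        refine Finset.sum_nonneg fun j _ => mul_nonneg ?_ (by split_ifs <;> norm_num)
        rw [sub_nonneg, Real.exp_le_exp]
        push_cast
        linarith
      linarith

/-- The converse estimate for the layer cake decomposition: rounding `f` up to an integer costs a
factor `exp (1 / 4)`. -/
theorem sum_indicator_le_exp_neg (f : ℝ) (J : ℕ) :
    (∑ j ∈ Finset.range J,
        (Real.exp (-(j : ℝ) / 4) - Real.exp (-((j + 1 : ℕ) : ℝ) / 4)) *
          (if f ≤ ((j + 1 : ℕ) : ℝ) then 1 else 0)) + Real.exp (-(J : ℝ) / 4)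
      ≤ max (Real.exp (-(J : ℝ) / 4)) (Real.exp (-(f - 1) / 4)) := by
  induction J with
  | zero => simp
  | succ J ih =>
    rw [Finset.sum_range_succ]
    split_ifs with h
    · push_cast at h
      have h1 : Real.exp (-(J : ℝ) / 4) ≤ Real.exp (-(f - 1) / 4) :=
        Real.exp_le_exp.2 (by linarith)
      rw [max_eq_right h1] at ih
      refine le_max_of_le_right ?_
      linarith
    · push_cast at h
      have h1 : Real.exp (-(f - 1) / 4) ≤ Real.exp (-(J : ℝ) / 4) :=
        Real.exp_le_exp.2 (by linarith)
      rw [max_eq_left h1] at ih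
      refine le_max_of_le_left ?_
      have : 0 ≤ Real.exp (-(((J + 1 : ℕ) : ℝ)) / 4) := (Real.exp_pos _).le
      linarith

section Halasz

variable {p : ℕ} [hp : Fact p.Prime]

/-- Halász-type comparison of two scales. The sums over the characters are compared level set by
level set. -/
theorem sum_exp_energy_le (hp3 : 3 ≤ p) {h : ℕ} (d : Fin h → ZMod p) (k : ℕ) (hk : 0 < k) (J : ℕ)
    (hJ : 36 * k ^ 2 * J < (Finset.univ.filter fun j => d j ≠ 0).card) :
    ∑ t, Real.exp (-energy d t / 4) ≤
      1 + 2 / k * ∑ t, Real.exp (-(energy d t / (k : ℝ) ^ 2) / 4) + p * Real.exp (-(J : ℝ) / 4) := by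
  have hk' : (0 : ℝ) < k := by exact_mod_cast hk
  set w : ℕ → ℝ := fun j => Real.exp (-(j : ℝ) / 4) - Real.exp (-((j + 1 : ℕ) : ℝ) / 4) with hw
  have hw0 : ∀ j, 0 ≤ w j := by
    intro j
    rw [hw, sub_nonneg, Real.exp_le_exp]
    push_cast
    linarith
  have hJ' : 36 * (k : ℝ) ^ 2 * J < (Finset.univ.filter fun j => d j ≠ 0).card := by
    exact_mod_cast hJ
  have hcard : ∀ l : ℝ, ∑ t : ZMod p, (if energy d t ≤ l then (1 : ℝ) else 0)
      = (Finset.univ.filter fun t => energy d t ≤ l).card := by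
    intro l
    rw [Finset.sum_boole]
  have step1 : ∑ t, Real.exp (-energy d t / 4) ≤
      (∑ j ∈ Finset.range J, w j *
        ((Finset.univ.filter fun t => energy d t ≤ ((j + 1 : ℕ) : ℝ)).card : ℝ))
        + p * Real.exp (-(J : ℝ) / 4) := by
    refine (Finset.sum_le_sum fun t _ =>
      exp_neg_le_sum_indicator (energy d t) (energy_nonneg d t) J).trans_eq ?_
    rw [Finset.sum_add_distrib, Finset.sum_const, Finset.card_univ, ZMod.card, nsmul_eq_mul,
      Finset.sum_comm]
    congr 1
    refine Finset.sum_congr rfl fun j _ => ?_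
    rw [← hcard, Finset.mul_sum]
  have step2 : (∑ j ∈ Finset.range J, w j *
        ((Finset.univ.filter fun t => energy d t ≤ ((j + 1 : ℕ) : ℝ)).card : ℝ)) ≤
      ∑ j ∈ Finset.range J, (w j + 1 / k * (w j *
        ((Finset.univ.filter fun t => energy d t ≤ (k : ℝ) ^ 2 * ((j + 1 : ℕ) : ℝ)).card : ℝ))) := by
    refine Finset.sum_le_sum fun j hj => ?_
    have hjJ : ((j + 1 : ℕ) : ℝ) ≤ J := by exact_mod_cast Finset.mem_range.1 hj
    have hl := card_level_le hp3 d k hk ((j + 1 : ℕ) : ℝ) (by positivity)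
      (lt_of_le_of_lt (by gcongr) hJ')
    refine (mul_le_mul_of_nonneg_left hl (hw0 j)).trans_eq ?_
    ring
  have step3 : ∑ j ∈ Finset.range J, w j ≤ 1 := by
    have := Finset.sum_range_sub' (fun j : ℕ => Real.exp (-(j : ℝ) / 4)) J
    rw [hw, this]
    simp only [Nat.cast_zero, neg_zero, zero_div, Real.exp_zero]
    linarith [Real.exp_pos (-(J : ℝ) / 4)]
  have step4 : ∑ j ∈ Finset.range J, w j *
        ((Finset.univ.filter fun t => energy d t ≤ (k : ℝ) ^ 2 * ((j + 1 : ℕ) : ℝ)).card : ℝ)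
      ≤ 2 * ∑ t, Real.exp (-(energy d t / (k : ℝ) ^ 2) / 4) := by
    have e : ∀ j : ℕ, w j *
        ((Finset.univ.filter fun t => energy d t ≤ (k : ℝ) ^ 2 * ((j + 1 : ℕ) : ℝ)).card : ℝ)
        = ∑ t, w j * (if energy d t / (k : ℝ) ^ 2 ≤ ((j + 1 : ℕ) : ℝ) then 1 else 0) := by
      intro j
      rw [← hcard, Finset.mul_sum]
      refine Finset.sum_congr rfl fun t _ => ?_
      simp only [div_le_iff₀' (pow_pos hk' 2)]
    rw [Finset.sum_congr rfl fun j _ => e j, Finset.sum_comm, Finset.mul_sum]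
    refine Finset.sum_le_sum fun t _ => ?_
    set g := energy d t / (k : ℝ) ^ 2
    have h1 := sum_indicator_le_exp_neg g J
    have h2 : Real.exp (-(g - 1) / 4) ≤ 2 * Real.exp (-g / 4) := by
      have e4 : -(g - 1) / 4 = 1 / 4 + -g / 4 := by ring
      rw [e4, Real.exp_add]
      gcongr
      have h5 := Real.exp_bound_div_one_sub_of_interval (x := 1 / 4) (by norm_num) (by norm_num)
      norm_num at h5 ⊢
      linarith
    have h3 : 0 ≤ 2 * Real.exp (-g / 4) := by positivity
    have h4 : max (Real.exp (-(J : ℝ) / 4)) (Real.exp (-(g - 1) / 4))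
        ≤ Real.exp (-(J : ℝ) / 4) + 2 * Real.exp (-g / 4) :=
      max_le (by linarith) (by linarith [Real.exp_pos (-(J : ℝ) / 4)])
    linarith
  rw [Finset.sum_add_distrib, ← Finset.mul_sum] at step2
  have step5 : 1 / (k : ℝ) * ∑ j ∈ Finset.range J, w j *
        ((Finset.univ.filter fun t => energy d t ≤ (k : ℝ) ^ 2 * ((j + 1 : ℕ) : ℝ)).card : ℝ)
      ≤ 2 / k * ∑ t, Real.exp (-(energy d t / (k : ℝ) ^ 2) / 4) := by
    calc _ ≤ 1 / (k : ℝ) * (2 * ∑ t, Real.exp (-(energy d t / (k : ℝ) ^ 2) / 4)) := by gcongr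
      _ = _ := by ring
  linarith

end Halasz

/-! ### The lazy random walk -/

section Lazy

variable {p : ℕ}

/-- The law on `ZMod p` of a lazy random sign: `0` with probability `1 - μ`, and `1`, `-1` with
probability `μ / 2` each. -/
noncomputable def stepWeight (μ : ℝ) (a : ZMod p) : ℝ :=
  (if a = 0 then 1 - μ else 0) + (if a = 1 then μ / 2 else 0) + (if a = -1 then μ / 2 else 0)

/-- The product law of `h` independent lazy random signs. -/
noncomputable def walkWeight (μ : ℝ) {h : ℕ} (ξ : Fin h → ZMod p) : ℝ := ∏ j, stepWeight μ (ξ j)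

theorem stepWeight_nonneg {μ : ℝ} (h0 : 0 ≤ μ) (h1 : μ ≤ 1 / 2) (a : ZMod p) :
    0 ≤ stepWeight μ a := by
  unfold stepWeight
  have : 0 ≤ 1 - μ := by linarith
  positivity

theorem walkWeight_nonneg {μ : ℝ} (h0 : 0 ≤ μ) (h1 : μ ≤ 1 / 2) {h : ℕ} (ξ : Fin h → ZMod p) :
    0 ≤ walkWeight μ ξ :=
  Finset.prod_nonneg fun _ _ => stepWeight_nonneg h0 h1 _

variable [hp : Fact p.Prime]

/-- The probability that `ξ ⬝ᵥ u = 0` for a vector `ξ` of independent lazy random signs. -/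
noncomputable def lazyProb (μ : ℝ) {h : ℕ} (u : Fin h → ZMod p) : ℝ :=
  ∑ ξ : Fin h → ZMod p, walkWeight μ ξ * (if ξ ⬝ᵥ u = 0 then 1 else 0)

theorem stepWeight_le (hp3 : 3 ≤ p) {μ : ℝ} (h1 : μ ≤ 1 / 2) (a : ZMod p) :
    stepWeight μ a ≤ 1 - μ := by
  have : Fact (2 < p) := ⟨hp3⟩
  have hne : (-1 : ZMod p) ≠ 1 := ZMod.neg_one_ne_one
  unfold stepWeight
  by_cases ha0 : a = 0
  · subst ha0
    simp
  · by_cases ha1 : a = 1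
    · subst ha1
      simp only [one_ne_zero, if_false, if_true, hne.symm]
      linarith
    · simp only [ha0, ha1, if_false]
      split_ifs <;> linarith

theorem sum_stepWeight (μ : ℝ) : ∑ a : ZMod p, stepWeight μ a = 1 := by
  unfold stepWeight
  simp only [Finset.sum_add_distrib, Finset.sum_ite_eq', Finset.mem_univ, if_true]
  ring

theorem sum_walkWeight (μ : ℝ) (h : ℕ) : ∑ ξ : Fin h → ZMod p, walkWeight μ ξ = 1 := by
  unfold walkWeight
  have := Finset.prod_univ_sum (fun _ : Fin h => (Finset.univ : Finset (ZMod p)))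
    (fun _ a => stepWeight μ a)
  rw [Fintype.piFinset_univ] at this
  rw [← this]
  simp [sum_stepWeight]

theorem lazyProb_nonneg {μ : ℝ} (h0 : 0 ≤ μ) (h1 : μ ≤ 1 / 2) {h : ℕ} (u : Fin h → ZMod p) :
    0 ≤ lazyProb μ u :=
  Finset.sum_nonneg fun ξ _ => mul_nonneg (walkWeight_nonneg h0 h1 ξ) (by split_ifs <;> norm_num)

theorem lazyProb_le_one {μ : ℝ} (h0 : 0 ≤ μ) (h1 : μ ≤ 1 / 2) {h : ℕ} (u : Fin h → ZMod p) :
    lazyProb μ u ≤ 1 := by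
  rw [← sum_walkWeight (p := p) μ h]
  refine Finset.sum_le_sum fun ξ _ => ?_
  have := walkWeight_nonneg h0 h1 ξ
  split_ifs <;> simp [this]

/-- For `μ ≤ 1 / 2` all terms on the right are non-negative: there is no cancellation in the
Fourier expansion of a return probability of the lazy walk. -/
theorem lazyProb_eq (μ : ℝ) {h : ℕ} (u : Fin h → ZMod p) :
    lazyProb μ u = (1 / p) * ∑ t : ZMod p, ∏ j,
      (1 - μ + μ * Real.cos (2 * Real.pi * circDist (t * u j))) := by
  have hp0 : (p : ℂ) ≠ 0 := by exact_mod_cast hp.out.ne_zero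
  have hstep : ∀ y : ZMod p, ∑ a : ZMod p, (stepWeight μ a : ℂ) * ZMod.stdAddChar (a * y)
      = ((1 - μ + μ * Real.cos (2 * Real.pi * circDist y) : ℝ) : ℂ) := by
    intro y
    have h1 : ∀ a : ZMod p, (stepWeight μ a : ℂ) * ZMod.stdAddChar (a * y)
        = (if a = 0 then (1 - μ : ℂ) else 0) + (if a = 1 then (μ / 2 : ℂ) * ZMod.stdAddChar y else 0)
          + (if a = -1 then (μ / 2 : ℂ) * ZMod.stdAddChar (-y) else 0) := by
      intro a
      unfold stepWeight
      push_cast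
      rw [add_mul, add_mul]
      congr 1
      · congr 1
        · split_ifs with h
          · subst h; simp
          · simp
        · split_ifs with h
          · subst h; simp
          · simp
      · split_ifs with h
        · subst h; simp
        · simp
    rw [Finset.sum_congr rfl fun a _ => h1 a]
    simp only [Finset.sum_add_distrib, Finset.sum_ite_eq', Finset.mem_univ, if_true]
    rw [add_assoc, ← mul_add, stdAddChar_add_neg]
    push_cast
    ring
  have hξ : ∀ ξ : Fin h → ZMod p, (if ξ ⬝ᵥ u = 0 then (1 : ℂ) else 0)
      = (1 / p) * ∑ t : ZMod p, (ZMod.stdAddChar (t * (ξ ⬝ᵥ u)) : ℂ) := by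
    intro ξ
    rw [AddChar.sum_mulShift _ (ZMod.isPrimitive_stdAddChar p), ZMod.card]
    split_ifs
    · field_simp
    · simp
  have hC : ((lazyProb μ u : ℝ) : ℂ) = (((1 / p) * ∑ t : ZMod p, ∏ j,
      (1 - μ + μ * Real.cos (2 * Real.pi * circDist (t * u j))) : ℝ) : ℂ) := by
    have hl : ((lazyProb μ u : ℝ) : ℂ) = ∑ ξ : Fin h → ZMod p,
        (walkWeight μ ξ : ℂ) * (if ξ ⬝ᵥ u = 0 then (1 : ℂ) else 0) := by
      unfold lazyProb
      push_cast
      refine Finset.sum_congr rfl fun ξ _ => ?_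
      split_ifs <;> simp
    rw [hl]
    simp only [hξ]
    rw [Complex.ofReal_mul, Complex.ofReal_sum]
    simp only [Complex.ofReal_prod, ← hstep]
    have e1 : ∀ ξ : Fin h → ZMod p, (walkWeight μ ξ : ℂ) * ((1 / p) *
        ∑ t : ZMod p, (ZMod.stdAddChar (t * (ξ ⬝ᵥ u)) : ℂ))
        = (1 / p) * ∑ t : ZMod p, ∏ j, ((stepWeight μ (ξ j) : ℂ)
          * ZMod.stdAddChar (ξ j * (t * u j))) := by
      intro ξ
      rw [mul_left_comm, Finset.mul_sum]
      congr 1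
      refine Finset.sum_congr rfl fun t _ => ?_
      rw [Finset.prod_mul_distrib]
      congr 1
      · unfold walkWeight
        push_cast
        rfl
      · rw [dotProduct, Finset.mul_sum]
        have := map_prod (ZMod.stdAddChar (N := p)).toMonoidHom
          (fun j => Multiplicative.ofAdd (t * (ξ j * u j))) Finset.univ
        refine Eq.trans this ?_
        refine Finset.prod_congr rfl fun j _ => ?_
        rw [mul_left_comm (ξ j)]
        rfl
    rw [Finset.sum_congr rfl fun ξ _ => e1 ξ, ← Finset.mul_sum, Finset.sum_comm]
    push_cast
    congr 1
    refine Finset.sum_congr rfl fun t _ => ?_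
    have := Finset.prod_univ_sum (fun _ : Fin h => (Finset.univ : Finset (ZMod p)))
      (fun j a => (stepWeight μ a : ℂ) * ZMod.stdAddChar (a * (t * u j)))
    rw [this, Fintype.piFinset_univ]
  exact_mod_cast hC

/-- Passing from the slice to the lazy walk gains a factor of order `1 / k`, unless the
differences along the matching are mostly zero or the probability is negligible. -/
theorem atomProb_le_lazyProb {n : ℕ} (hn : Even n) (hp3 : 3 ≤ p) (v : Fin n → ZMod p) {h : ℕ}
    (a b : Fin h → Fin n) (hab : ∀ i j, a i ≠ b j) (ha : Function.Injective a)
    (hb : Function.Injective b) (hh : 8 * h ≤ n) (k : ℕ) (hk : 0 < k) (J : ℕ)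
    (hJ : 36 * k ^ 2 * J < (Finset.univ.filter fun j => v (b j) - v (a j) ≠ 0).card) :
    atomProb v ≤ 2 / k * lazyProb (1 / (160 * (k : ℝ) ^ 2)) (fun j => v (b j) - v (a j))
      + (1 / p + Real.exp (-(J : ℝ) / 4)) := by
  have hp0 : (0 : ℝ) < p := by exact_mod_cast hp.out.pos
  have hk' : (1 : ℝ) ≤ k := by exact_mod_cast hk
  have hk0 : (0 : ℝ) < k := by linarith
  set d : Fin h → ZMod p := fun j => v (b j) - v (a j) with hd
  set μ : ℝ := 1 / (160 * (k : ℝ) ^ 2) with hμ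
  have hμ0 : 0 < μ := by positivity
  have hμ1 : μ ≤ 1 / 160 := by
    rw [hμ]
    exact one_div_le_one_div_of_le (by norm_num) (by nlinarith)
  have h1 := atomProb_le hn v a b hab ha hb (by simpa using hh)
  have h2 : ∀ t : ZMod p, ∏ j, (7 / 8 + Real.cos (Real.pi * circDist (t * (v (b j) - v (a j)))) / 8)
      ≤ Real.exp (-energy d t / 4) := by
    intro t
    have e : Real.exp (-energy d t / 4) = ∏ j, Real.exp (-(circDist (t * d j) ^ 2) / 4) := by
      rw [← Real.exp_sum, energy, ← Finset.sum_neg_distrib, Finset.sum_div]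
    rw [e]
    refine Finset.prod_le_prod (fun j _ => ?_) fun j _ => ?_
    · linarith [Real.neg_one_le_cos (Real.pi * circDist (t * (v (b j) - v (a j))))]
    · have h3 := cos_pi_circDist_le (t * d j)
      have h4 := Real.add_one_le_exp (-(circDist (t * d j) ^ 2) / 4)
      simp only [hd] at h3 h4 ⊢
      linarith
  have h3 : ∀ t : ZMod p, Real.exp (-(energy d t / (k : ℝ) ^ 2) / 4)
      ≤ ∏ j, (1 - μ + μ * Real.cos (2 * Real.pi * circDist (t * d j))) := by
    intro t
    have e : Real.exp (-(energy d t / (k : ℝ) ^ 2) / 4)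
        = ∏ j, Real.exp (-(40 * μ * circDist (t * d j) ^ 2)) := by
      rw [← Real.exp_sum]
      congr 1
      rw [energy, Finset.sum_neg_distrib, ← Finset.mul_sum, hμ]
      field_simp
      ring
    rw [e]
    refine Finset.prod_le_prod (fun j _ => (Real.exp_pos _).le) fun j _ => ?_
    have h5 := one_sub_le_cos_two_pi_circDist (t * d j)
    have h6 := circDist_nonneg (t * d j)
    have h7 := circDist_le_half (t * d j)
    set x := circDist (t * d j)
    set y := 20 * μ * x ^ 2 with hy
    have hy0 : 0 ≤ y := by positivity
    have hy1 : y ≤ 1 / 2 := by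
      have : x ^ 2 ≤ 1 := by nlinarith
      calc y ≤ 20 * (1 / 160) * 1 := by rw [hy]; gcongr
        _ ≤ 1 / 2 := by norm_num
    have h8 : Real.exp (-(40 * μ * x ^ 2)) ≤ 1 - y := by
      have e2 : -(40 * μ * x ^ 2) = -(2 * y) := by rw [hy]; ring
      rw [e2, Real.exp_neg]
      have h9 := Real.add_one_le_exp (2 * y)
      rw [inv_le_iff_one_le_mul₀ (Real.exp_pos _)]
      nlinarith
    nlinarith
  have h4 := sum_exp_energy_le hp3 d k hk J hJ
  calc atomProb v ≤ (1 / p) * ∑ t, Real.exp (-energy d t / 4) := by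
        refine h1.trans ?_
        gcongr with t _
        exact h2 t
    _ ≤ (1 / p) * (1 + 2 / k * ∑ t, Real.exp (-(energy d t / (k : ℝ) ^ 2) / 4)
          + p * Real.exp (-(J : ℝ) / 4)) := by gcongr
    _ ≤ (1 / p) * (1 + 2 / k * ∑ t : ZMod p, ∏ j,
          (1 - μ + μ * Real.cos (2 * Real.pi * circDist (t * d j)))
          + p * Real.exp (-(J : ℝ) / 4)) := by
        gcongr with t _
        exact h3 t
    _ = _ := by
        rw [lazyProb_eq]
        field_simp
        ring

end Lazy

/-! ### Subspaces orthogonal to lazy walks -/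

section Orthogonal

variable {p : ℕ} [hp : Fact p.Prime]

theorem finrank_inf_ker_add_one {V : Type*} [AddCommGroup V] [Module (ZMod p) V]
    [FiniteDimensional (ZMod p) V] (U : Submodule (ZMod p) V) (φ : V →ₗ[ZMod p] ZMod p)
    (hφ : ∃ u ∈ U, φ u ≠ 0) :
    Module.finrank (ZMod p) (U ⊓ LinearMap.ker φ : Submodule (ZMod p) V) + 1
      = Module.finrank (ZMod p) U := by
  have hne : φ ∘ₗ U.subtype ≠ 0 := by
    obtain ⟨u, hu, hne⟩ := hφ
    intro h
    exact hne (LinearMap.congr_fun h ⟨u, hu⟩)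
  have h1 := Module.Dual.finrank_ker_add_one_of_ne_zero hne
  have h2 : U ⊓ LinearMap.ker φ = (LinearMap.ker (φ ∘ₗ U.subtype)).map U.subtype := by
    rw [LinearMap.ker_comp, Submodule.map_comap_subtype]
  rw [h2, Submodule.finrank_map_subtype_eq, h1]

open scoped Classical in
theorem card_filter_mem_submodule {h : ℕ} (U : Submodule (ZMod p) (Fin h → ZMod p)) :
    (Finset.univ.filter fun u => u ∈ U).card = p ^ Module.finrank (ZMod p) U := by
  rw [← Fintype.card_subtype]
  have := Module.card_eq_pow_finrank (K := ZMod p) (V := U)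
  rw [ZMod.card] at this
  rw [← this]

open scoped Classical in
/-- Odlyzko's bound. If `u ∈ U` has `u i ≠ 0`, then the condition `ξ ⬝ᵥ u = 0` determines `ξ i` from
the other coordinates, while the subspace of `U` where the `i`-th coordinate vanishes does not
involve `ξ i` at all. -/
theorem sum_walkWeight_orthogonal_le (hp3 : 3 ≤ p) {μ : ℝ} (h0 : 0 ≤ μ) (h1 : μ ≤ 1 / 2) {h : ℕ}
    (r : ℕ) : ∀ U : Submodule (ZMod p) (Fin h → ZMod p), Module.finrank (ZMod p) U = r →
      ∑ ξ : Fin h → ZMod p, walkWeight μ ξ * (if ∀ u ∈ U, ξ ⬝ᵥ u = 0 then 1 else 0)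
        ≤ (1 - μ) ^ r := by
  induction r with
  | zero =>
    intro U _
    refine le_trans (Finset.sum_le_sum fun ξ _ => ?_) (sum_walkWeight (p := p) μ h).le
    have := walkWeight_nonneg h0 h1 ξ
    split_ifs <;> simp [this]
  | succ r ih =>
    intro U hU
    have hUbot : U ≠ ⊥ := by
      rintro rfl
      simp at hU
    obtain ⟨u₀, hu₀, hne⟩ := (Submodule.ne_bot_iff U).1 hUbot
    obtain ⟨i, hi⟩ := Function.ne_iff.1 hne
    rw [Pi.zero_apply] at hi
    set φ : (Fin h → ZMod p) →ₗ[ZMod p] ZMod p := LinearMap.proj i with hφ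
    set U' := U ⊓ LinearMap.ker φ with hU'
    have hr : Module.finrank (ZMod p) U' = r := by
      have h2 : Module.finrank (ZMod p) U' + 1 = Module.finrank (ZMod p) U :=
        finrank_inf_ker_add_one U φ ⟨u₀, hu₀, hi⟩
      omega
    have hih := ih U' hr
    have hμ : 0 ≤ 1 - μ := by linarith
    refine le_trans ?_ ((mul_le_mul_of_nonneg_left hih hμ).trans_eq (by ring))
    rw [Finset.mul_sum, ← Equiv.sum_comp (Equiv.funSplitAt i (ZMod p)).symm,
      ← Equiv.sum_comp (Equiv.funSplitAt i (ZMod p)).symm, Fintype.sum_prod_type_right,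
      Fintype.sum_prod_type_right]
    refine Finset.sum_le_sum fun η _ => ?_
    set e := (Equiv.funSplitAt i (ZMod p)).symm with he
    have hei : ∀ a, e (a, η) i = a := fun a => by simp [he, Equiv.funSplitAt_symm_apply]
    have hej : ∀ (a) (j : {j // j ≠ i}), e (a, η) j = η j := fun a j => by
      simp [he, Equiv.funSplitAt_symm_apply, j.2]
    have hW : ∀ a, walkWeight μ (e (a, η)) = stepWeight μ a * ∏ j, stepWeight μ (η j) := by
      intro a
      unfold walkWeight
      rw [Fintype.prod_eq_mul_prod_subtype_ne _ i, hei]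
      simp only [hej]
    have hdot : ∀ (a) (u : Fin h → ZMod p), e (a, η) ⬝ᵥ u
        = a * u i + ∑ j : {j // j ≠ i}, η j * u j := by
      intro a u
      rw [dotProduct, Fintype.sum_eq_add_sum_subtype_ne _ i, hei]
      simp only [hej]
    have hR : 0 ≤ ∏ j : {j // j ≠ i}, stepWeight μ (η j) :=
      Finset.prod_nonneg fun _ _ => stepWeight_nonneg h0 h1 _
    set R := ∏ j : {j // j ≠ i}, stepWeight μ (η j)
    have hindep : ∀ a, (∀ u ∈ U', e (a, η) ⬝ᵥ u = 0) ↔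
        ∀ u ∈ U', ∑ j : {j // j ≠ i}, η j * u j = 0 := by
      intro a
      refine forall₂_congr fun u hu => ?_
      have hui : u i = 0 := (Submodule.mem_inf.1 hu).2
      rw [hdot, hui, mul_zero, zero_add]
    simp only [hindep, hW]
    by_cases hP : ∀ u ∈ U', ∑ j : {j // j ≠ i}, η j * u j = 0
    · simp only [if_pos hP, mul_one]
      rw [← Finset.mul_sum, ← Finset.sum_mul, sum_stepWeight, one_mul]
      set a₀ : ZMod p := -(∑ j : {j // j ≠ i}, η j * u₀ j) / u₀ i
      calc ∑ a, stepWeight μ a * R * (if ∀ u ∈ U, e (a, η) ⬝ᵥ u = 0 then 1 else 0)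
          ≤ ∑ a, if a = a₀ then (1 - μ) * R else 0 := by
            refine Finset.sum_le_sum fun a _ => ?_
            split_ifs with hA hB hB
            · rw [mul_one]
              exact mul_le_mul_of_nonneg_right (stepWeight_le hp3 h1 a) hR
            · exfalso
              apply hB
              have := hA u₀ hu₀
              rw [hdot] at this
              rw [eq_div_iff hi]
              linear_combination this
            · rw [mul_zero]
              positivity
            · rw [mul_zero]
        _ = (1 - μ) * R := by simp
    · simp only [if_neg hP, mul_zero, Finset.sum_const_zero]
      refine (Finset.sum_eq_zero fun a _ => ?_).le
      rw [if_neg, mul_zero]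
      intro hA
      exact hP ((hindep a).1 fun u hu => hA u (Submodule.mem_inf.1 hu).1)

open scoped Classical in
/-- For an `N`-row matrix of independent lazy signs, the expected number of vectors of `U` in its
kernel. While the part of `U` annihilated so far has dimension above `m`, a new row divides its
expected size by at least `p / 2`. -/
theorem sum_lazyProb_pow_le (hp3 : 3 ≤ p) {μ : ℝ} (h0 : 0 ≤ μ) (h1 : μ ≤ 1 / 2) {h : ℕ} (m : ℕ)
    (hm : (1 - μ) ^ m ≤ 1 / p) (N : ℕ) : ∀ U : Submodule (ZMod p) (Fin h → ZMod p),
      ∑ u ∈ Finset.univ.filter (fun u => u ∈ U), lazyProb μ u ^ N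
        ≤ (p : ℝ) ^ m + (2 / p) ^ N * (p : ℝ) ^ Module.finrank (ZMod p) U := by
  have hp0 : (0 : ℝ) < p := by exact_mod_cast hp.out.pos
  have hp1 : (1 : ℝ) ≤ p := by exact_mod_cast hp.out.one_le
  induction N with
  | zero =>
    intro U
    simp only [pow_zero, Finset.sum_const, nsmul_eq_mul, mul_one, one_mul]
    rw [card_filter_mem_submodule]
    push_cast
    linarith [pow_nonneg hp0.le m]
  | succ N ih =>
    intro U
    set r := Module.finrank (ZMod p) U with hr
    by_cases hrm : r ≤ m
    · calc ∑ u ∈ Finset.univ.filter (fun u => u ∈ U), lazyProb μ u ^ (N + 1)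
          ≤ ∑ u ∈ Finset.univ.filter (fun u => u ∈ U), (1 : ℝ) :=
            Finset.sum_le_sum fun u _ =>
              pow_le_one₀ (lazyProb_nonneg h0 h1 u) (lazyProb_le_one h0 h1 u)
        _ = (p : ℝ) ^ r := by
            rw [Finset.sum_const, card_filter_mem_submodule, nsmul_eq_mul, mul_one, Nat.cast_pow]
        _ ≤ (p : ℝ) ^ m := pow_le_pow_right₀ hp1 hrm
        _ ≤ _ := le_add_of_nonneg_right (by positivity)
    · have hmr : m ≤ r := by omega
      obtain ⟨r', hr'⟩ : ∃ r', r = r' + 1 := ⟨r - 1, by omega⟩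
      set K : (Fin h → ZMod p) → Submodule (ZMod p) (Fin h → ZMod p) :=
        fun ξ => U ⊓ LinearMap.ker (dotProductEquiv (ZMod p) (Fin h) ξ) with hK
      have hmem : ∀ ξ u, u ∈ K ξ ↔ u ∈ U ∧ ξ ⬝ᵥ u = 0 := fun ξ u => by
        simp [hK, Submodule.mem_inf, LinearMap.mem_ker]
      have hfin : ∀ ξ, (p : ℝ) ^ Module.finrank (ZMod p) (K ξ)
          ≤ (p : ℝ) ^ r * (if ∀ u ∈ U, ξ ⬝ᵥ u = 0 then 1 else 0) + (p : ℝ) ^ r' := by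
        intro ξ
        split_ifs with hA
        · have : K ξ = U := by
            ext u
            rw [hmem]
            exact ⟨fun h => h.1, fun h => ⟨h, hA u h⟩⟩
          rw [this, mul_one]
          exact le_add_of_nonneg_right (by positivity)
        · have h2 := finrank_inf_ker_add_one U (dotProductEquiv (ZMod p) (Fin h) ξ)
            (by push Not at hA; simpa using hA)
          have h3 : Module.finrank (ZMod p) (K ξ) = r' := by
            rw [← hr, hr'] at h2
            exact Nat.succ.inj h2
          rw [h3, mul_zero, zero_add]
      have hsum : ∑ u ∈ Finset.univ.filter (fun u => u ∈ U), lazyProb μ u ^ (N + 1)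
          = ∑ ξ, walkWeight μ ξ *
            ∑ u ∈ Finset.univ.filter (fun u => u ∈ K ξ), lazyProb μ u ^ N := by
        have e1 : ∀ u : Fin h → ZMod p, lazyProb μ u ^ (N + 1) = ∑ ξ, walkWeight μ ξ *
            ((if ξ ⬝ᵥ u = 0 then 1 else 0) * lazyProb μ u ^ N) := by
          intro u
          rw [pow_succ', lazyProb, Finset.sum_mul]
          simp only [mul_assoc]
        rw [Finset.sum_congr rfl fun u _ => e1 u, Finset.sum_comm]
        refine Finset.sum_congr rfl fun ξ _ => ?_
        rw [← Finset.mul_sum]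
        congr 1
        simp only [hmem, ite_mul, one_mul, zero_mul]
        rw [← Finset.sum_filter, Finset.filter_filter]
      have hodl := sum_walkWeight_orthogonal_le hp3 h0 h1 r U rfl
      have hmu0 : 0 ≤ 1 - μ := by linarith
      have hpow : (1 - μ) ^ r ≤ 1 / p :=
        (pow_le_pow_of_le_one hmu0 (by linarith) hmr).trans hm
      rw [hsum]
      calc ∑ ξ, walkWeight μ ξ * ∑ u ∈ Finset.univ.filter (fun u => u ∈ K ξ), lazyProb μ u ^ N
          ≤ ∑ ξ, walkWeight μ ξ * ((p : ℝ) ^ m + (2 / p) ^ N *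
              ((p : ℝ) ^ r * (if ∀ u ∈ U, ξ ⬝ᵥ u = 0 then 1 else 0) + (p : ℝ) ^ r')) := by
            refine Finset.sum_le_sum fun ξ _ => mul_le_mul_of_nonneg_left ?_ (walkWeight_nonneg h0 h1 ξ)
            refine (ih (K ξ)).trans ?_
            gcongr
            exact hfin ξ
        _ = (p : ℝ) ^ m * ∑ ξ : Fin h → ZMod p, walkWeight μ ξ + (2 / p) ^ N * ((p : ℝ) ^ r *
              (∑ ξ : Fin h → ZMod p, walkWeight μ ξ * (if ∀ u ∈ U, ξ ⬝ᵥ u = 0 then 1 else 0))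
              + (p : ℝ) ^ r' * ∑ ξ : Fin h → ZMod p, walkWeight μ ξ) := by
            simp only [Finset.mul_sum, ← Finset.sum_add_distrib]
            refine Finset.sum_congr rfl fun ξ _ => ?_
            ring
        _ ≤ (p : ℝ) ^ m + (2 / p) ^ N * ((p : ℝ) ^ r * (1 / p) + (p : ℝ) ^ r') := by
            rw [sum_walkWeight, mul_one, mul_one]
            gcongr
            exact hodl.trans hpow
        _ = (p : ℝ) ^ m + (2 / p) ^ (N + 1) * (p : ℝ) ^ r := by
            rw [hr', pow_succ (2 / (p : ℝ)), pow_succ (p : ℝ) r']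
            field_simp
            ring

theorem sum_lazyProb_pow_univ_le (hp3 : 3 ≤ p) {μ : ℝ} (h0 : 0 ≤ μ) (h1 : μ ≤ 1 / 2) (h m : ℕ)
    (hm : (1 - μ) ^ m ≤ 1 / p) :
    ∑ u : Fin h → ZMod p, lazyProb μ u ^ h ≤ (p : ℝ) ^ m + 2 ^ h := by
  have hp0 : (0 : ℝ) < p := by exact_mod_cast hp.out.pos
  have := sum_lazyProb_pow_le hp3 h0 h1 (h := h) m hm h ⊤
  rw [finrank_top, Module.finrank_fin_fun, ← mul_pow, div_mul_cancel₀ _ hp0.ne'] at this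
  simpa using this

end Orthogonal

/-! ### Structured vectors -/

section Path

variable {p : ℕ}

/-- The differences of `v` along the edges `(8 x + g, 8 x + g + 1)`, `x < h`, of the path
`0, 1, …, 8 h`. For each `g < 8` these edges form a matching, and the eight matchings together
exhaust the path. -/
def pathDiff {n h : ℕ} (hh : 8 * h < n) (v : Fin n → ZMod p) (g : Fin 8) (x : Fin h) : ZMod p :=
  v ⟨8 * x + g + 1, by omega⟩ - v ⟨8 * x + g, by omega⟩

/-- The values of `v` at the last vertex of the path and beyond it, padded by `0`. -/
def pathTail {n : ℕ} (h : ℕ) (v : Fin n → ZMod p) (c : Fin 8) : ZMod p :=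
  if hc : 8 * h + c < n then v ⟨8 * h + c, hc⟩ else 0

theorem pathTail_pathDiff_injective {n h : ℕ} (hh : 8 * h < n) (hn : n ≤ 8 * h + 8) :
    Function.Injective fun v : Fin n → ZMod p => (pathTail h v, pathDiff hh v) := by
  intro v v' hvv
  obtain ⟨ht, hd⟩ := Prod.ext_iff.1 hvv
  have key : ∀ t i (hi : i < n), n - 1 - i = t → v ⟨i, hi⟩ = v' ⟨i, hi⟩ := by
    intro t
    induction t with
    | zero =>
      intro i hi hit
      have h1 := congrFun ht ⟨i - 8 * h, by omega⟩
      have e : 8 * h + (i - 8 * h) = i := by omega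
      simpa [pathTail, e, hi] using h1
    | succ t ih =>
      intro i hi hit
      by_cases hi8 : 8 * h ≤ i
      · have h1 := congrFun ht ⟨i - 8 * h, by omega⟩
        have e : 8 * h + (i - 8 * h) = i := by omega
        simpa [pathTail, e, hi] using h1
      · have h1 := congrFun (congrFun hd ⟨i % 8, by omega⟩) ⟨i / 8, by omega⟩
        have h2 := ih (i + 1) (by omega) (by omega)
        have e : 8 * (i / 8) + i % 8 = i := Nat.div_add_mod i 8
        simp only [pathDiff, e] at h1
        rw [h2] at h1
        exact sub_right_inj.1 h1
  ext i
  exact key _ i.1 i.2 rfl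

/-- A vector is well spread along the path if along each of the eight matchings at least `s` of
its differences are nonzero. -/
def WellSpread {n h : ℕ} (hh : 8 * h < n) (s : ℕ) (v : Fin n → ZMod p) : Prop :=
  ∀ g, s ≤ (Finset.univ.filter fun x => pathDiff hh v g x ≠ 0).card

variable [hp : Fact p.Prime]

/-- As `v` is determined by its differences along the path and at most eight values, a sum over `v`
factors over the eight matchings. -/
theorem sum_prod_pathDiff_le {n h : ℕ} (hh : 8 * h < n) (hn : n ≤ 8 * h + 8)
    (Φ : (Fin h → ZMod p) → ℝ) (hΦ : ∀ u, 0 ≤ Φ u) :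
    ∑ v : Fin n → ZMod p, ∏ g, Φ (pathDiff hh v g) ≤ (p : ℝ) ^ 8 * (∑ u, Φ u) ^ 8 := by
  have hinj := pathTail_pathDiff_injective (p := p) hh hn
  set F : (Fin 8 → ZMod p) × (Fin 8 → Fin h → ZMod p) → ℝ := fun y => ∏ g, Φ (y.2 g) with hF
  have h1 : ∑ v : Fin n → ZMod p, ∏ g, Φ (pathDiff hh v g)
      = ∑ y ∈ Finset.univ.image (fun v : Fin n → ZMod p => (pathTail h v, pathDiff hh v)), F y := by
    rw [Finset.sum_image fun _ _ _ _ e => hinj e]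
  rw [h1]
  refine (Finset.sum_le_sum_of_subset_of_nonneg (Finset.subset_univ _) fun y _ _ =>
    Finset.prod_nonneg fun g _ => hΦ _).trans_eq ?_
  rw [Fintype.sum_prod_type]
  have h2 : ∑ d : Fin 8 → Fin h → ZMod p, ∏ g, Φ (d g) = (∑ u, Φ u) ^ 8 := by
    have := Finset.prod_univ_sum (fun _ : Fin 8 => (Finset.univ : Finset (Fin h → ZMod p)))
      (fun _ u => Φ u)
    rw [Fintype.piFinset_univ] at this
    rw [← this]
    simp
  simp only [h2, Finset.sum_const, Finset.card_univ, Fintype.card_fun, ZMod.card,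
    Fintype.card_fin, nsmul_eq_mul, Nat.cast_pow]

open scoped Classical in
/-- Among the well spread vectors, those with large atom probability contribute little to the
expected number of kernel vectors of a random matrix: each factor `atomProb v` is much smaller than
the corresponding probability for the lazy walk, and for the lazy walk the expected number of kernel
vectors is not large. The `g`-th of eight blocks of `h` rows is compared with a walk along the `g`-th
matching. -/
theorem sum_wellSpread_le (hp3 : 3 ≤ p) {n h : ℕ} (hne : Even n) (hh : 8 * h < n)
    (hn : n ≤ 8 * h + 8) (k : ℕ) (hk : 0 < k) (J s m : ℕ) (hs : 36 * k ^ 2 * J < s)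
    (hm : (1 - 1 / (160 * (k : ℝ) ^ 2)) ^ m ≤ 1 / p) :
    ∑ v : Fin n → ZMod p, (if WellSpread hh s v then
        (if 2 * (1 / p + Real.exp (-(J : ℝ) / 4)) < atomProb v then atomProb v ^ (8 * h) else 0)
        else 0)
      ≤ (4 / k : ℝ) ^ (8 * h) * ((p : ℝ) ^ 8 * ((p : ℝ) ^ m + 2 ^ h) ^ 8) := by
  have hk' : (1 : ℝ) ≤ k := by exact_mod_cast hk
  have hk0 : (0 : ℝ) < k := by linarith
  set μ : ℝ := 1 / (160 * (k : ℝ) ^ 2) with hμ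
  have hμ0 : 0 ≤ μ := by positivity
  have hμ1 : μ ≤ 1 / 2 := by
    rw [hμ]
    exact one_div_le_one_div_of_le (by norm_num) (by nlinarith)
  have hpt : ∀ v : Fin n → ZMod p, (if WellSpread hh s v then
        (if 2 * (1 / p + Real.exp (-(J : ℝ) / 4)) < atomProb v then atomProb v ^ (8 * h) else 0)
        else 0) ≤ (4 / k : ℝ) ^ (8 * h) * ∏ g, lazyProb μ (pathDiff hh v g) ^ h := by
    intro v
    have hrhs : 0 ≤ (4 / k : ℝ) ^ (8 * h) * ∏ g, lazyProb μ (pathDiff hh v g) ^ h :=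
      mul_nonneg (by positivity)
        (Finset.prod_nonneg fun g _ => pow_nonneg (lazyProb_nonneg hμ0 hμ1 _) _)
    split_ifs with hw hat
    · have hg : ∀ g, atomProb v ≤ 4 / k * lazyProb μ (pathDiff hh v g) := by
        intro g
        have h1 := atomProb_le_lazyProb hne hp3 v (h := h)
          (fun x => ⟨8 * x + g, by omega⟩) (fun x => ⟨8 * x + g + 1, by omega⟩)
          (fun i j e => by have := Fin.mk.inj e; omega)
          (fun i j e => Fin.ext (by have := Fin.mk.inj e; omega))
          (fun i j e => Fin.ext (by have := Fin.mk.inj e; omega)) hh.le k hk J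
          (lt_of_lt_of_le hs (hw g))
        have h2 : atomProb v ≤ 2 / k * lazyProb μ (pathDiff hh v g)
          + (1 / p + Real.exp (-(J : ℝ) / 4)) := h1
        have h3 : (4 / k : ℝ) * lazyProb μ (pathDiff hh v g)
            = 2 * (2 / k * lazyProb μ (pathDiff hh v g)) := by ring
        rw [h3]
        linarith
      calc atomProb v ^ (8 * h) = ∏ _g : Fin 8, atomProb v ^ h := by
            rw [Finset.prod_const, Finset.card_univ, Fintype.card_fin, ← pow_mul, mul_comm]
        _ ≤ ∏ g : Fin 8, (4 / k * lazyProb μ (pathDiff hh v g)) ^ h :=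
            Finset.prod_le_prod (fun g _ => pow_nonneg (atomProb_nonneg v) _)
              fun g _ => pow_le_pow_left₀ (atomProb_nonneg v) (hg g) _
        _ = _ := by
            simp only [mul_pow, Finset.prod_mul_distrib]
            rw [Finset.prod_const, Finset.card_univ, Fintype.card_fin, ← pow_mul, mul_comm h]
    · exact hrhs
    · exact hrhs
  refine (Finset.sum_le_sum fun v _ => hpt v).trans ?_
  rw [← Finset.mul_sum]
  gcongr
  refine (sum_prod_pathDiff_le hh hn (fun u => lazyProb μ u ^ h)
    fun u => pow_nonneg (lazyProb_nonneg hμ0 hμ1 u) _).trans ?_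
  gcongr
  · exact Finset.sum_nonneg fun u _ => pow_nonneg (lazyProb_nonneg hμ0 hμ1 u) _
  · exact sum_lazyProb_pow_univ_le hp3 hμ0 hμ1 h m hm

end Path

section Rearrangement

variable {p : ℕ}

theorem exists_disjoint_pairs {n : ℕ} (i₀ : Fin n) (v : Fin n → ZMod p) (K : ℕ)
    (hv : ∀ a, 2 * K ≤ (Finset.univ.filter fun i => v i ≠ a).card) :
    ∃ f : ℕ → Bool → Fin n, (∀ x < K, v (f x true) ≠ v (f x false)) ∧
      ∀ x < K, ∀ y < K, ∀ b c, f x b = f y c → x = y ∧ b = c := by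
  induction K with
  | zero => exact ⟨fun _ _ => i₀, by simp, by simp⟩
  | succ K ih =>
    obtain ⟨f, hf1, hf2⟩ := ih fun a => le_trans (by omega) (hv a)
    set D : Finset (Fin n) :=
      (Finset.range K ×ˢ (Finset.univ : Finset Bool)).image fun y => f y.1 y.2 with hD
    have hDcard : D.card ≤ 2 * K := by
      refine Finset.card_image_le.trans ?_
      simp [mul_comm]
    have hmem : ∀ x < K, ∀ b, f x b ∈ D := fun x hx b =>
      Finset.mem_image.2 ⟨(x, b), by simp [hx], rfl⟩
    have hex : ∃ i j, i ∉ D ∧ j ∉ D ∧ v i ≠ v j := by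
      by_contra! hcon
      by_cases hall : ∃ i, i ∉ D
      · obtain ⟨i, hi⟩ := hall
        have hsub : (Finset.univ.filter fun j => v j ≠ v i) ⊆ D := by
          intro j hj
          by_contra hjD
          exact (Finset.mem_filter.1 hj).2 (hcon i j hi hjD).symm
        have := Finset.card_le_card hsub
        have := hv (v i)
        omega
      · push Not at hall
        have h1 : (Finset.univ.filter fun j => v j ≠ v i₀) ⊆ D := fun j _ => hall j
        have := Finset.card_le_card h1
        have := hv (v i₀)
        omega
    obtain ⟨i, j, hi, hj, hij⟩ := hex
    have hne : i ≠ j := fun h => hij (congrArg v h)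
    have hfi : ∀ x < K, ∀ b, f x b ≠ i := fun x hx b h => hi (h ▸ hmem x hx b)
    have hfj : ∀ x < K, ∀ b, f x b ≠ j := fun x hx b h => hj (h ▸ hmem x hx b)
    refine ⟨fun x b => if x = K then (if b then i else j) else f x b, ?_, ?_⟩
    · intro x hx
      by_cases hxK : x = K
      · simpa [hxK] using hij
      · simpa [hxK] using hf1 x (by omega)
    · intro x hx y hy b c h
      by_cases hxK : x = K <;> by_cases hyK : y = K
      · refine ⟨hxK.trans hyK.symm, ?_⟩
        simp only [hxK, hyK, if_true] at h
        cases b <;> cases c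
        · rfl
        · exact absurd h.symm hne
        · exact absurd h hne
        · rfl
      · exfalso
        have h1 := hfi y (by omega) c
        have h2 := hfj y (by omega) c
        simp only [hxK, hyK, if_true, if_false] at h
        cases b
        · exact h2 h.symm
        · exact h1 h.symm
      · exfalso
        have h1 := hfi x (by omega) b
        have h2 := hfj x (by omega) b
        simp only [hxK, hyK, if_true, if_false] at h
        cases c
        · exact h2 h
        · exact h1 h
      · simp only [hxK, hyK, if_false] at h
        exact hf2 x (by omega) y (by omega) b c h

theorem exists_perm_extending {α κ : Type*} [Finite α] (a b : κ → α)
    (ha : Function.Injective a) (hb : Function.Injective b) :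
    ∃ σ : Equiv.Perm α, ∀ y, σ (a y) = b y := by
  classical
  have : Fintype α := Fintype.ofFinite α
  set e : {x // x ∈ Set.range a} ≃ {x // x ∈ Set.range b} :=
    (Equiv.ofInjective a ha).symm.trans (Equiv.ofInjective b hb) with he
  refine ⟨e.extendSubtype, fun y => ?_⟩
  rw [Equiv.extendSubtype_apply_of_mem e (a y) ⟨y, rfl⟩]
  have h1 : (Equiv.ofInjective a ha).symm ⟨a y, ⟨y, rfl⟩⟩ = y :=
    Equiv.ofInjective_symm_apply ha y
  simp only [he, Equiv.trans_apply]
  change ((Equiv.ofInjective b hb ((Equiv.ofInjective a ha).symm ⟨a y, ⟨y, rfl⟩⟩) : _) : α) = b y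
  rw [h1]
  rfl

/-- The end points of `8 s` disjoint edges of the path, the `x`-th of them in the `x / s`-th
matching. -/
def edgeEnd {n h s : ℕ} (hh : 8 * h < n) (hs : 8 * s ≤ h) (y : Fin (8 * s) × Bool) : Fin n :=
  ⟨8 * y.1 + y.1 / s + y.2.toNat, by
    have h1 : (y.1 : ℕ) / s < 8 := Nat.div_lt_of_lt_mul (by have := y.1.2; omega)
    have h2 := y.1.2
    have h3 := Bool.toNat_le y.2
    omega⟩

theorem edgeEnd_injective {n h s : ℕ} (hh : 8 * h < n) (hs : 8 * s ≤ h) :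
    Function.Injective (edgeEnd hh hs) := by
  rintro ⟨x, b⟩ ⟨y, c⟩ hxy
  have e := Fin.mk.inj hxy
  simp only at e
  have hb := Bool.toNat_le b
  have hc := Bool.toNat_le c
  have hlt : ∀ x y : Fin (8 * s), (x : ℕ) < y → (x : ℕ) / s ≤ y / s := fun x y h =>
    Nat.div_le_div_right h.le
  rcases lt_trichotomy (x : ℕ) y with h1 | h1 | h1
  · have := hlt x y h1
    omega
  · rw [h1] at e
    have h2 : b.toNat = c.toNat := by omega
    have h3 : b = c := by cases b <;> cases c <;> simp_all
    rw [Prod.mk.injEq]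
    exact ⟨Fin.ext h1, h3⟩
  · have := hlt y x h1
    omega

theorem exists_wellSpread {n h s : ℕ} (hh : 8 * h < n) (hs : 8 * s ≤ h) (v : Fin n → ZMod p)
    (hv : ∀ a, 16 * s ≤ (Finset.univ.filter fun i => v i ≠ a).card) :
    ∃ f : Fin (8 * s) × Bool → Fin n, Function.Injective f ∧ ∀ σ : Equiv.Perm (Fin n),
      (∀ y, σ (edgeEnd hh hs y) = f y) → WellSpread hh s (v ∘ σ) := by
  obtain ⟨f, hf1, hf2⟩ := exists_disjoint_pairs ⟨0, by omega⟩ v (8 * s)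
    fun a => le_trans (by omega) (hv a)
  refine ⟨fun y => f y.1 y.2, ?_, ?_⟩
  · rintro ⟨x, b⟩ ⟨y, c⟩ hxy
    obtain ⟨h1, h2⟩ := hf2 x x.2 y y.2 b c hxy
    rw [Prod.mk.injEq]
    exact ⟨Fin.ext h1, h2⟩
  · intro σ hσ g
    -- The `g`-th matching contains the edges numbered `g s, …, g s + s - 1`.
    have hinj : Function.Injective fun j : Fin s => (⟨g * s + j, by
        have : (g : ℕ) * s ≤ 7 * s := Nat.mul_le_mul_right s (by omega)
        omega⟩ : Fin h) := by
      intro i j hij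
      have := Fin.mk.inj hij
      exact Fin.ext (by omega)
    have hcard : s = (Finset.univ.image fun j : Fin s => (⟨g * s + j, by
        have : (g : ℕ) * s ≤ 7 * s := Nat.mul_le_mul_right s (by omega)
        omega⟩ : Fin h)).card := by
      rw [Finset.card_image_of_injective _ hinj, Finset.card_univ, Fintype.card_fin]
    refine hcard.le.trans (Finset.card_le_card ?_)
    intro x hx
    obtain ⟨j, -, rfl⟩ := Finset.mem_image.1 hx
    have hlt : (g : ℕ) * s + j < 8 * s := by
      have : (g : ℕ) * s ≤ 7 * s := Nat.mul_le_mul_right s (by omega)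
      omega
    have hdiv : ((g : ℕ) * s + j) / s = g := by
      rw [Nat.div_eq_iff (by omega), mul_comm (g : ℕ) s]
      omega
    have e0 := hσ (⟨g * s + j, hlt⟩, false)
    have e1 := hσ (⟨g * s + j, hlt⟩, true)
    simp only [edgeEnd, hdiv, Bool.toNat_false, Bool.toNat_true, add_zero] at e0 e1
    refine Finset.mem_filter.2 ⟨Finset.mem_univ _, ?_⟩
    have e2 := sub_ne_zero.2 (hf1 _ hlt)
    rw [← e0, ← e1] at e2
    exact e2

open scoped Classical in
/-- Sums over vectors of which no coordinate value is dominant reduce to sums over well spread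
vectors. A suitable permutation of the coordinates makes such a vector well spread, and it only
matters where the permutation sends `16 s` coordinates, which leaves few cases. -/
theorem sum_le_sum_wellSpread {n h s : ℕ} [NeZero p] (hh : 8 * h < n) (hs : 8 * s ≤ h)
    (X : (Fin n → ZMod p) → ℝ) (hX : ∀ v, 0 ≤ X v)
    (hXσ : ∀ v (σ : Equiv.Perm (Fin n)), X (v ∘ σ) = X v) :
    ∑ v, (if ∀ a, 16 * s ≤ (Finset.univ.filter fun i => v i ≠ a).card then X v else 0)
      ≤ (n : ℝ) ^ (16 * s) * ∑ v, (if WellSpread hh s v then X v else 0) := by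
  have hex : ∀ f : Fin (8 * s) × Bool → Fin n, ∃ σ : Equiv.Perm (Fin n), Function.Injective f →
      ∀ y, σ (edgeEnd hh hs y) = f y := by
    intro f
    by_cases hf : Function.Injective f
    · obtain ⟨σ, hσ⟩ := exists_perm_extending _ f (edgeEnd_injective hh hs) hf
      exact ⟨σ, fun _ => hσ⟩
    · exact ⟨1, fun h => absurd h hf⟩
  choose σ hσ using hex
  have hpt : ∀ v : Fin n → ZMod p,
      (if ∀ a, 16 * s ≤ (Finset.univ.filter fun i => v i ≠ a).card then X v else 0)
        ≤ ∑ f, (if WellSpread hh s (v ∘ σ f) then X (v ∘ σ f) else 0) := by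
    intro v
    have h0 : ∀ f ∈ (Finset.univ : Finset (Fin (8 * s) × Bool → Fin n)),
        0 ≤ (if WellSpread hh s (v ∘ σ f) then X (v ∘ σ f) else 0) := fun f _ => by
      split_ifs
      · exact hX _
      · exact le_rfl
    split_ifs with hv
    · obtain ⟨f, hf, hwell⟩ := exists_wellSpread hh hs v hv
      refine le_trans ?_ (Finset.single_le_sum h0 (Finset.mem_univ f))
      rw [if_pos (hwell (σ f) (hσ f hf)), hXσ]
    · exact Finset.sum_nonneg h0
  refine (Finset.sum_le_sum fun v _ => hpt v).trans_eq ?_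
  rw [Finset.sum_comm]
  have hinv : ∀ f, ∑ v : Fin n → ZMod p, (if WellSpread hh s (v ∘ σ f) then X (v ∘ σ f) else 0)
      = ∑ v, (if WellSpread hh s v then X v else 0) := fun f =>
    Equiv.sum_comp (Equiv.arrowCongr (σ f).symm (Equiv.refl (ZMod p)))
      (fun v => if WellSpread hh s v then X v else 0)
  rw [Finset.sum_congr rfl fun f _ => hinv f, Finset.sum_const, Finset.card_univ, Fintype.card_fun,
    Fintype.card_prod, Fintype.card_fin, Fintype.card_fin, Fintype.card_bool, nsmul_eq_mul]
  push_cast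
  congr 2
  ring

end Rearrangement

/-! ### Nearly constant vectors -/

open scoped Classical in
theorem card_nearlyConstant_le {n p : ℕ} [NeZero p] (i₀ : Fin n) (r : ℕ) :
    (Finset.univ.filter fun v : Fin n → ZMod p =>
      ∃ a, (Finset.univ.filter fun i => v i ≠ a).card ≤ r).card ≤ p * (n * p) ^ r := by
  -- A nearly constant vector is encoded by its main value and a list of `r` corrections.
  set F : ZMod p × (Fin r → Fin n × ZMod p) → Fin n → ZMod p := fun y i =>
    if h : ∃ j, (y.2 j).1 = i then (y.2 h.choose).2 else y.1 with hF
  have hsub : (Finset.univ.filter fun v : Fin n → ZMod p =>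
      ∃ a, (Finset.univ.filter fun i => v i ≠ a).card ≤ r) ⊆ Finset.univ.image F := by
    intro v hv
    obtain ⟨a, ha⟩ := (Finset.mem_filter.1 hv).2
    set D := Finset.univ.filter fun i => v i ≠ a with hD
    set g : Fin r → Fin n := fun j =>
      if h : (j : ℕ) < D.card then (D.equivFin.symm ⟨j, h⟩ : Fin n) else i₀ with hg
    have hcover : ∀ i ∈ D, ∃ j, g j = i := by
      intro i hi
      have hlt := (D.equivFin ⟨i, hi⟩).2
      refine ⟨⟨D.equivFin ⟨i, hi⟩, hlt.trans_le ha⟩, ?_⟩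
      simp [hg]
    refine Finset.mem_image.2 ⟨(a, fun j => (g j, v (g j))), Finset.mem_univ _, ?_⟩
    ext i
    simp only [hF]
    split_ifs with h
    · exact congrArg v h.choose_spec
    · by_contra hne
      exact h (hcover i (Finset.mem_filter.2 ⟨Finset.mem_univ _, fun e => hne e.symm⟩))
  refine (Finset.card_le_card hsub).trans (Finset.card_image_le.trans_eq ?_)
  rw [Finset.card_univ, Fintype.card_prod, Fintype.card_fun, Fintype.card_prod, Fintype.card_fin,
    Fintype.card_fin, ZMod.card]

theorem atomProb_le_one {n p : ℕ} (v : Fin n → ZMod p) : atomProb v ≤ 1 := by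
  unfold atomProb
  rw [div_le_one (choose_half_pos n)]
  have h := Finset.card_filter_le ((Finset.univ : Finset (Fin n)).powersetCard (n / 2))
    fun A => ∑ i ∈ A, v i = 0
  rw [Finset.card_powersetCard, Finset.card_univ, Fintype.card_fin] at h
  exact_mod_cast h

/-- A constant vector `a ≠ 0` has inner product `a * (n / 2) ≠ 0` with every row. -/
theorem exists_ne_of_atomProb_pos {n p : ℕ} [hp : Fact p.Prime] (hn : 2 ≤ n) (hnp : n < p)
    (v : Fin n → ZMod p) (hv : v ≠ 0) (hpos : 0 < atomProb v) : ∃ i j, v i ≠ v j := by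
  by_contra! hcon
  obtain ⟨i, hi⟩ := Function.ne_iff.1 hv
  rw [Pi.zero_apply] at hi
  have hcard : (sliceZeros v).card ≠ 0 := by
    intro h
    rw [atomProb, h] at hpos
    simp at hpos
  obtain ⟨A, hA⟩ := Finset.card_pos.1 (Nat.pos_of_ne_zero hcard)
  obtain ⟨hA1, hA2⟩ := Finset.mem_filter.1 hA
  rw [Finset.sum_congr rfl fun j _ => hcon j i, Finset.sum_const,
    (Finset.mem_powersetCard.1 hA1).2, nsmul_eq_mul] at hA2
  rcases mul_eq_zero.1 hA2 with h | h
  · rw [ZMod.natCast_eq_zero_iff] at h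
    have := Nat.le_of_dvd (by omega) h
    omega
  · exact hi h

/-! ### The union bound over normal vectors -/

section Union

variable {n p : ℕ}

/-- The configurations of `n` half-size subsets of `Fin n`, encoding the matrices whose rows are
the indicator vectors of these subsets. -/
def rowConfigs (n : ℕ) : Finset (Fin n → Finset (Fin n)) :=
  Fintype.piFinset fun _ => Finset.univ.powersetCard (n / 2)

theorem card_rowConfigs (n : ℕ) : (rowConfigs n).card = n.choose (n / 2) ^ n := by
  simp [rowConfigs]

/-- The matrix over `K` whose rows are the indicator vectors of the sets `R i`. -/
def indicatorMatrix (K : Type*) [Zero K] [One K] (R : Fin n → Finset (Fin n)) :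
    Matrix (Fin n) (Fin n) K :=
  Matrix.of fun i j => if j ∈ R i then 1 else 0

theorem indicatorMatrix_mulVec {K : Type*} [CommRing K] (R : Fin n → Finset (Fin n))
    (v : Fin n → K) (i : Fin n) : (indicatorMatrix K R).mulVec v i = ∑ j ∈ R i, v j := by
  simp [indicatorMatrix, Matrix.mulVec, dotProduct, Finset.sum_ite_mem]

theorem card_subtype_ne_fin (i : Fin n) : Fintype.card {j // j ≠ i} = n - 1 := by
  simp [Fintype.card_subtype_compl]

/-- The rows other than the `i`-th all lie in `Z`, independently. -/
theorem card_others_in (i : Fin n) (Z : Finset (Finset (Fin n))) :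
    ((rowConfigs n).filter fun R => ∀ j, j ≠ i → R j ∈ Z).card
      ≤ n.choose (n / 2) * Z.card ^ (n - 1) := by
  have hsub : ((rowConfigs n).filter fun R => ∀ j, j ≠ i → R j ∈ Z) ⊆ Fintype.piFinset
      fun j => if j = i then Finset.univ.powersetCard (n / 2) else Z := by
    intro R hR
    obtain ⟨h1, h2⟩ := Finset.mem_filter.1 hR
    rw [Fintype.mem_piFinset]
    intro j
    split_ifs with hj
    · exact (Fintype.mem_piFinset.1 h1) j
    · exact h2 j hj
  refine (Finset.card_le_card hsub).trans_eq ?_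
  rw [Fintype.card_piFinset, Fintype.prod_eq_mul_prod_subtype_ne _ i, if_pos rfl,
    Finset.card_powersetCard, Finset.card_univ, Fintype.card_fin,
    Finset.prod_congr rfl fun j _ => by rw [if_neg j.2], Finset.prod_const, Finset.card_univ,
    card_subtype_ne_fin]

/-- If a vector is chosen as a function of the rows other than the `i`-th, then it is unlikely that
it has small atom probability and is orthogonal to the `i`-th row. -/
theorem card_row_orthogonal_le [NeZero p] (i : Fin n)
    (w : (Fin n → Finset (Fin n)) → Fin n → ZMod p) (ρ₀ : ℝ) (hρ : 0 ≤ ρ₀) :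
    (((rowConfigs n).filter fun R => atomProb (w (Function.update R i ∅)) ≤ ρ₀ ∧
      R i ∈ sliceZeros (w (Function.update R i ∅))).card : ℝ)
      ≤ ρ₀ * (n.choose (n / 2) : ℝ) ^ n := by
  classical
  set T : Finset (Fin n → Finset (Fin n)) :=
    Fintype.piFinset fun j => if j = i then {∅} else Finset.univ.powersetCard (n / 2) with hT
  have hTcard : T.card = n.choose (n / 2) ^ (n - 1) := by
    rw [hT, Fintype.card_piFinset, Fintype.prod_eq_mul_prod_subtype_ne _ i, if_pos rfl,
      Finset.card_singleton, one_mul, Finset.prod_congr rfl fun j _ => by rw [if_neg j.2],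
      Finset.prod_const, Finset.card_univ, card_subtype_ne_fin, Finset.card_powersetCard,
      Finset.card_univ, Fintype.card_fin]
  set S := (rowConfigs n).filter fun R => atomProb (w (Function.update R i ∅)) ≤ ρ₀ ∧
      R i ∈ sliceZeros (w (Function.update R i ∅)) with hS
  have hmaps : ∀ R ∈ S, Function.update R i ∅ ∈ T := by
    intro R hR
    have h1 := (Finset.mem_filter.1 hR).1
    rw [hT, Fintype.mem_piFinset]
    intro j
    split_ifs with hj
    · subst hj; simp
    · rw [Function.update_of_ne hj]
      exact (Fintype.mem_piFinset.1 h1) j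
  rw [Finset.card_eq_sum_card_fiberwise hmaps, Nat.cast_sum]
  have hfib : ∀ R' ∈ T, ((S.filter fun R => Function.update R i ∅ = R').card : ℝ)
      ≤ ρ₀ * n.choose (n / 2) := by
    intro R' _
    by_cases hat : atomProb (w R') ≤ ρ₀
    · have hsub : (S.filter fun R => Function.update R i ∅ = R')
          ⊆ (sliceZeros (w R')).image fun A => Function.update R' i A := by
        intro R hR
        obtain ⟨h1, h2⟩ := Finset.mem_filter.1 hR
        have h3 := (Finset.mem_filter.1 h1).2.2
        rw [h2] at h3
        refine Finset.mem_image.2 ⟨R i, h3, ?_⟩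
        rw [← h2, Function.update_idem, Function.update_eq_self]
      have h4 := (Finset.card_le_card hsub).trans Finset.card_image_le
      have h5 : ((S.filter fun R => Function.update R i ∅ = R').card : ℝ)
          ≤ (sliceZeros (w R')).card := by exact_mod_cast h4
      rw [card_sliceZeros] at h5
      exact h5.trans (by gcongr)
    · have : (S.filter fun R => Function.update R i ∅ = R') = ∅ := by
        refine Finset.filter_eq_empty_iff.2 fun R hR h => hat ?_
        rw [← h]
        exact (Finset.mem_filter.1 hR).2.1
      rw [this, Finset.card_empty, Nat.cast_zero]
      positivity
  refine (Finset.sum_le_sum hfib).trans_eq ?_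
  rw [Finset.sum_const, hTcard, nsmul_eq_mul, Nat.cast_pow]
  have hn : n = n - 1 + 1 := by have := i.2; omega
  have : (n.choose (n / 2) : ℝ) ^ n = (n.choose (n / 2) : ℝ) ^ (n - 1) * n.choose (n / 2) := by
    rw [← pow_succ, ← hn]
  rw [this]
  ring

open scoped Classical in
/-- A singular matrix has a row in the span of the other rows, hence orthogonal to every vector
orthogonal to the others. Either such a vector has small atom probability, or one of the vectors
with large atom probability is orthogonal to `n - 1` rows. -/
theorem card_singular_le [hp : Fact p.Prime] (ρ₀ : ℝ) (hρ : 0 ≤ ρ₀) :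
    (((rowConfigs n).filter fun R => (indicatorMatrix (ZMod p) R).det = 0).card : ℝ)
      ≤ n * (ρ₀ + ∑ v : Fin n → ZMod p, if v ≠ 0 ∧ ρ₀ < atomProb v then atomProb v ^ (n - 1) else 0)
        * (n.choose (n / 2) : ℝ) ^ n := by
  set C : ℝ := (n.choose (n / 2) : ℝ) with hC
  have hker : ∀ R : Fin n → Finset (Fin n), ∃ v : Fin n → ZMod p,
      (∃ i, R i = ∅) → v ≠ 0 ∧ ∀ j, ∑ l ∈ R j, v l = 0 := by
    intro R
    by_cases h : ∃ i, R i = ∅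
    · obtain ⟨i, hi⟩ := h
      have hdet : (indicatorMatrix (ZMod p) R).det = 0 := by
        refine Matrix.det_eq_zero_of_row_eq_zero i fun j => ?_
        simp [indicatorMatrix, hi]
      obtain ⟨v, hv, h0⟩ := Matrix.exists_mulVec_eq_zero_iff.2 hdet
      refine ⟨v, fun _ => ⟨hv, fun j => ?_⟩⟩
      rw [← indicatorMatrix_mulVec, h0, Pi.zero_apply]
    · exact ⟨0, fun h' => absurd h' h⟩
  choose w hw using hker
  set V : Finset (Fin n → ZMod p) := Finset.univ.filter fun v => v ≠ 0 ∧ ρ₀ < atomProb v with hV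
  set G : Fin n → Finset (Fin n → Finset (Fin n)) := fun i =>
    (rowConfigs n).filter fun R => atomProb (w (Function.update R i ∅)) ≤ ρ₀ ∧
      R i ∈ sliceZeros (w (Function.update R i ∅)) with hG
  set B : Fin n → Finset (Fin n → Finset (Fin n)) := fun i =>
    V.biUnion fun v => (rowConfigs n).filter fun R => ∀ j, j ≠ i → R j ∈ sliceZeros v with hB
  have hcover : ((rowConfigs n).filter fun R => (indicatorMatrix (ZMod p) R).det = 0)
      ⊆ Finset.univ.biUnion fun i => G i ∪ B i := by
    intro R hR
    obtain ⟨hRc, hdet⟩ := Finset.mem_filter.1 hR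
    obtain ⟨y, hy, hyM⟩ := Matrix.exists_vecMul_eq_zero_iff.2 hdet
    obtain ⟨i, hi⟩ := Function.ne_iff.1 hy
    rw [Pi.zero_apply] at hi
    set v := w (Function.update R i ∅) with hv
    obtain ⟨hv0, hvz⟩ := hw (Function.update R i ∅) ⟨i, Function.update_self _ _ _⟩
    rw [← hv] at hv0 hvz
    have hother : ∀ j, j ≠ i → ∑ l ∈ R j, v l = 0 := fun j hj => by
      have := hvz j
      rwa [Function.update_of_ne hj] at this
    have hown : ∑ l ∈ R i, v l = 0 := by
      have h1 : y ⬝ᵥ (indicatorMatrix (ZMod p) R).mulVec v = 0 := by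
        rw [Matrix.dotProduct_mulVec, hyM, zero_dotProduct]
      rw [dotProduct, Finset.sum_eq_single i] at h1
      · rw [indicatorMatrix_mulVec] at h1
        exact (mul_eq_zero.1 h1).resolve_left hi
      · intro j _ hj
        rw [indicatorMatrix_mulVec, hother j hj, mul_zero]
      · exact fun h => absurd (Finset.mem_univ i) h
    have hmem : ∀ j, ∑ l ∈ R j, v l = 0 → R j ∈ sliceZeros v := fun j hj =>
      Finset.mem_filter.2 ⟨(Fintype.mem_piFinset.1 hRc) j, hj⟩
    refine Finset.mem_biUnion.2 ⟨i, Finset.mem_univ i, Finset.mem_union.2 ?_⟩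
    by_cases hat : atomProb v ≤ ρ₀
    · exact Or.inl (Finset.mem_filter.2 ⟨hRc, hat, hmem i hown⟩)
    · exact Or.inr (Finset.mem_biUnion.2 ⟨v, Finset.mem_filter.2
        ⟨Finset.mem_univ _, hv0, not_le.1 hat⟩, Finset.mem_filter.2
        ⟨hRc, fun j hj => hmem j (hother j hj)⟩⟩)
  have hGcard : ∀ i, ((G i).card : ℝ) ≤ ρ₀ * C ^ n := fun i => card_row_orthogonal_le i w ρ₀ hρ
  have hBcard : ∀ i, ((B i).card : ℝ) ≤ (∑ v ∈ V, atomProb v ^ (n - 1)) * C ^ n := by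
    intro i
    have h1 : ((B i).card : ℝ) ≤ ∑ v ∈ V,
        (((rowConfigs n).filter fun R => ∀ j, j ≠ i → R j ∈ sliceZeros v).card : ℝ) := by
      exact_mod_cast Finset.card_biUnion_le
    refine h1.trans ?_
    rw [Finset.sum_mul]
    refine Finset.sum_le_sum fun v _ => ?_
    have h2 : (((rowConfigs n).filter fun R => ∀ j, j ≠ i → R j ∈ sliceZeros v).card : ℝ)
        ≤ C * ((sliceZeros v).card : ℝ) ^ (n - 1) := by
      rw [hC]
      exact_mod_cast card_others_in i (sliceZeros v)
    refine h2.trans_eq ?_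
    rw [card_sliceZeros, mul_pow, ← hC]
    have hn : n = n - 1 + 1 := by have := i.2; omega
    have : C ^ n = C ^ (n - 1) * C := by rw [← pow_succ, ← hn]
    rw [this]
    ring
  have hcard : (((rowConfigs n).filter fun R => (indicatorMatrix (ZMod p) R).det = 0).card : ℝ)
      ≤ ∑ i : Fin n, (((G i).card : ℝ) + (B i).card) := by
    have h1 := (Finset.card_le_card hcover).trans Finset.card_biUnion_le
    have h2 : ∑ i : Fin n, (G i ∪ B i).card ≤ ∑ i : Fin n, ((G i).card + (B i).card) :=
      Finset.sum_le_sum fun i _ => Finset.card_union_le _ _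
    exact_mod_cast h1.trans h2
  refine hcard.trans ((Finset.sum_le_sum fun i _ => add_le_add (hGcard i) (hBcard i)).trans_eq ?_)
  rw [Finset.sum_const, Finset.card_univ, Fintype.card_fin, nsmul_eq_mul, hV, Finset.sum_filter]
  ring

end Union

/-! ### Choice of parameters -/

section Parameters

open scoped Classical in
/-- The expected number of vectors with large atom probability in the kernel of `n - 1` rows. -/
theorem sum_large_atomProb_le {n p : ℕ} [hp : Fact p.Prime] (hne : Even n) (hn8 : 8 ≤ n)
    (hp3 : 3 ≤ p) (hnp : n < p) {h : ℕ} (hh : 8 * h < n) (hn : n ≤ 8 * h + 8) (k : ℕ) (hk : 0 < k)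
    (J s m : ℕ) (hsh : 8 * s ≤ h) (hs : 36 * k ^ 2 * J < s)
    (hm : (1 - 1 / (160 * (k : ℝ) ^ 2)) ^ m ≤ 1 / p) :
    ∑ v : Fin n → ZMod p, (if v ≠ 0 ∧ 2 * (1 / p + Real.exp (-(J : ℝ) / 4)) < atomProb v
        then atomProb v ^ (n - 1) else 0)
      ≤ (p * (n * p) ^ (16 * s) : ℝ) * (143 / 144) ^ (n - 1) +
        (n : ℝ) ^ (16 * s) * ((4 / k : ℝ) ^ (8 * h) * ((p : ℝ) ^ 8 * ((p : ℝ) ^ m + 2 ^ h) ^ 8)) := by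
  set ρ₀ : ℝ := 2 * (1 / p + Real.exp (-(J : ℝ) / 4)) with hρ
  have hρ0 : 0 ≤ ρ₀ := by positivity
  set X : (Fin n → ZMod p) → ℝ := fun v => if ρ₀ < atomProb v then atomProb v ^ (8 * h) else 0
    with hXdef
  have hX : ∀ v, 0 ≤ X v := fun v => by
    simp only [hXdef]
    split_ifs
    · exact pow_nonneg (atomProb_nonneg v) _
    · exact le_rfl
  have h1 := sum_le_sum_wellSpread hh hsh X hX fun v σ => by
    simp only [hXdef, atomProb_comp_perm]
  have h2 := sum_wellSpread_le hp3 hne hh hn k hk J s m hs hm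
  have h3 : ∑ v : Fin n → ZMod p, (if ∃ a, (Finset.univ.filter fun i => v i ≠ a).card ≤ 16 * s
      then (143 / 144 : ℝ) ^ (n - 1) else 0)
      ≤ (p * (n * p) ^ (16 * s) : ℝ) * (143 / 144) ^ (n - 1) := by
    rw [← Finset.sum_filter, Finset.sum_const, nsmul_eq_mul]
    have := card_nearlyConstant_le (p := p) (⟨0, by omega⟩ : Fin n) (16 * s)
    gcongr
    exact_mod_cast this
  refine le_trans ?_ (add_le_add h3 (h1.trans (mul_le_mul_of_nonneg_left h2 (by positivity))))
  rw [← Finset.sum_add_distrib]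
  refine Finset.sum_le_sum fun v _ => ?_
  have hnear0 : 0 ≤ (if ∃ a, (Finset.univ.filter fun i => v i ≠ a).card ≤ 16 * s
      then (143 / 144 : ℝ) ^ (n - 1) else 0) := by positivity
  have hfar0 : 0 ≤ (if ∀ a, 16 * s ≤ (Finset.univ.filter fun i => v i ≠ a).card
      then X v else 0) := by
    split_ifs
    · exact hX v
    · exact le_rfl
  by_cases hv : v ≠ 0 ∧ ρ₀ < atomProb v
  · rw [if_pos hv]
    by_cases hnear : ∃ a, (Finset.univ.filter fun i => v i ≠ a).card ≤ 16 * s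
    · obtain ⟨i, j, hij⟩ := exists_ne_of_atomProb_pos (by omega) hnp v hv.1 (hρ0.trans_lt hv.2)
      refine le_add_of_le_of_nonneg ?_ hfar0
      rw [if_pos hnear]
      exact pow_le_pow_left₀ (atomProb_nonneg v) (atomProb_le_of_ne hne hn8 hp3 v hij) _
    · refine le_add_of_nonneg_of_le hnear0 ?_
      push Not at hnear
      rw [if_pos fun a => (hnear a).le]
      simp only [hXdef]
      rw [if_pos hv.2]
      exact pow_le_pow_of_le_one (atomProb_nonneg v) (atomProb_le_one v) (by omega)
  · rw [if_neg hv]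
    exact add_nonneg hnear0 hfar0

theorem pow_le_two_pow_neg (w n : ℕ) (h : w ≤ (n - 1) / 144) :
    (143 / 144 : ℝ) ^ (n - 1) ≤ (1 / 2) ^ w := by
  have h1 : (143 / 144 : ℝ) ^ 144 ≤ 1 / 2 := by norm_num
  calc (143 / 144 : ℝ) ^ (n - 1) ≤ (143 / 144) ^ (144 * w) :=
        pow_le_pow_of_le_one (by norm_num) (by norm_num) (by omega)
    _ = ((143 / 144) ^ 144) ^ w := pow_mul _ _ _
    _ ≤ (1 / 2) ^ w := pow_le_pow_left₀ (by norm_num) h1 w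

theorem exp_neg_le_half_pow (w : ℕ) : Real.exp (-(w : ℝ)) ≤ (1 / 2) ^ w := by
  have h1 : Real.exp (-1) ≤ 1 / 2 := by linarith [Real.exp_neg_one_lt_d9]
  calc Real.exp (-(w : ℝ)) = Real.exp (-1) ^ w := by rw [← Real.exp_nat_mul]; ring_nf
    _ ≤ (1 / 2) ^ w := pow_le_pow_left₀ (Real.exp_pos _).le h1 w

theorem six_mul_pow_le_exp (w : ℕ) (hw : 10 ^ 7 ≤ w) :
    6 * ((w : ℝ) + 1) ^ 4 ≤ Real.exp (2 / 5 * w) := by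
  have hw' : (10 : ℝ) ^ 7 ≤ w := by exact_mod_cast hw
  have h1 := Real.pow_div_factorial_le_exp (2 / 5 * (w : ℝ)) (by positivity) 5
  refine le_trans ?_ h1
  have h2 : (w : ℝ) + 1 ≤ 2 * w := by linarith
  have h3 : ((w : ℝ) + 1) ^ 4 ≤ (2 * w) ^ 4 := by gcongr
  have h4 : (w : ℝ) ^ 4 * 10 ^ 7 ≤ w ^ 4 * w := by gcongr
  have h5 : (Nat.factorial 5 : ℝ) = 120 := by norm_num [Nat.factorial]
  rw [h5]
  have h6 : 0 ≤ (w : ℝ) ^ 4 := by positivity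
  calc 6 * ((w : ℝ) + 1) ^ 4 ≤ 6 * (2 * w) ^ 4 := by gcongr
    _ = 96 * (w : ℝ) ^ 4 := by ring
    _ ≤ (2 / 5) ^ 5 / 120 * (w ^ 4 * w) := by linarith
    _ = (2 / 5 * (w : ℝ)) ^ 5 / 120 := by ring

theorem exp_le_two_pow (w : ℕ) : Real.exp (13 / 20 * w) ≤ 2 ^ w := by
  have h1 : Real.exp (13 / 20) ≤ 2 := by
    rw [← Real.le_log_iff_exp_le two_pos]
    linarith [Real.log_two_gt_d9]
  calc Real.exp (13 / 20 * w) = Real.exp (13 / 20) ^ w := by rw [← Real.exp_nat_mul, mul_comm]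
    _ ≤ 2 ^ w := pow_le_pow_left₀ (Real.exp_pos _).le h1 w

/-- With `w ≈ n ^ (1 / 4)` and a prime `p ≈ 2 ^ w`, the proportion of singular matrices modulo `p`
is at most of order `n / 2 ^ w`. -/
theorem card_singular_le_of_fourth_root {n w p : ℕ} [hp : Fact p.Prime] (hne : Even n)
    (hw : 10 ^ 7 ≤ w) (hwn : w ^ 4 ≤ n) (hn2 : n ≤ 2 ^ w) (hp1 : 2 ^ w < p)
    (hp2 : p ≤ 2 ^ (w + 1)) :
    (((rowConfigs n).filter fun R => (indicatorMatrix (ZMod p) R).det = 0).card : ℝ)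
      ≤ 6 * n * (1 / 2) ^ w * (n.choose (n / 2) : ℝ) ^ n := by
  -- All quantities below are `O (w ^ 2)`, whereas `n` is at least `10 ^ 14 * w ^ 2`.
  obtain ⟨q, hq⟩ : ∃ q, q = w ^ 2 := ⟨_, rfl⟩
  have hqw : 10 ^ 7 * w ≤ q := by rw [hq, sq]; exact Nat.mul_le_mul_right w hw
  have hqn : 10 ^ 14 * q ≤ n := by
    refine le_trans ?_ hwn
    calc 10 ^ 14 * q = (10 ^ 7) ^ 2 * q := by norm_num
      _ ≤ w ^ 2 * q := by gcongr
      _ = w ^ 4 := by rw [hq]; ring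
  set h := (n - 1) / 8 with hh
  have hp0 : (0 : ℝ) < p := by exact_mod_cast hp.out.pos
  have hp1' : (2 : ℝ) ^ w ≤ p := by exact_mod_cast hp1.le
  have hp2' : (p : ℝ) ≤ 2 ^ (w + 1) := by exact_mod_cast hp2
  have hn2' : (n : ℝ) ≤ 2 ^ w := by exact_mod_cast hn2
  have hp3 : 3 ≤ p := by
    have : 2 ^ 1 ≤ 2 ^ w := Nat.pow_le_pow_right (by norm_num) (by omega)
    omega
  have hhalf : ∀ j : ℕ, (1 / 2 : ℝ) ^ j = 1 / 2 ^ j := fun j => by rw [one_div_pow]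
  have hm : (1 - 1 / (160 * ((64 : ℕ) : ℝ) ^ 2)) ^ (655360 * (w + 1)) ≤ 1 / (p : ℝ) := by
    have h1 : (1 - 1 / (160 * ((64 : ℕ) : ℝ) ^ 2)) ≤ Real.exp (-(1 / 655360)) := by
      have := Real.add_one_le_exp (-(1 / 655360 : ℝ))
      norm_num at this ⊢
      linarith
    calc (1 - 1 / (160 * ((64 : ℕ) : ℝ) ^ 2)) ^ (655360 * (w + 1))
        ≤ Real.exp (-(1 / 655360)) ^ (655360 * (w + 1)) :=
          pow_le_pow_left₀ (by norm_num) h1 _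
      _ = Real.exp (-((w + 1 : ℕ) : ℝ)) := by
          rw [← Real.exp_nat_mul]
          congr 1
          push_cast
          ring
      _ ≤ (1 / 2) ^ (w + 1) := exp_neg_le_half_pow _
      _ ≤ 1 / (p : ℝ) := by
          rw [hhalf]
          exact one_div_le_one_div_of_le hp0 hp2'
  have hsum := sum_large_atomProb_le (n := n) (p := p) hne (by omega) hp3 (by omega) (h := h)
    (by omega) (by omega) 64 (by norm_num) (4 * w) (589825 * w) (655360 * (w + 1)) (by omega)
    (by omega) hm
  have hsing := card_singular_le (n := n) (p := p)
    (2 * (1 / p + Real.exp (-((4 * w : ℕ) : ℝ) / 4))) (by positivity)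
  have hρ : 2 * (1 / (p : ℝ) + Real.exp (-((4 * w : ℕ) : ℝ) / 4)) ≤ 4 * (1 / 2) ^ w := by
    have h1 : 1 / (p : ℝ) ≤ (1 / 2) ^ w := by
      rw [hhalf]
      exact one_div_le_one_div_of_le (by positivity) hp1'
    have h2 : Real.exp (-((4 * w : ℕ) : ℝ) / 4) ≤ (1 / 2) ^ w := by
      refine le_trans (le_of_eq ?_) (exp_neg_le_half_pow w)
      congr 1
      push_cast
      ring
    linarith
  have hnear : (p * (n * p) ^ (16 * (589825 * w)) : ℝ) * (143 / 144) ^ (n - 1) ≤ (1 / 2) ^ w := by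
    have e1 : (p * (n * p) ^ (16 * (589825 * w)) : ℝ)
        ≤ 2 ^ ((w + 1) + (2 * w + 1) * (16 * (589825 * w))) := by
      calc (p * (n * p) ^ (16 * (589825 * w)) : ℝ)
          ≤ 2 ^ (w + 1) * (2 ^ w * 2 ^ (w + 1)) ^ (16 * (589825 * w)) := by gcongr
        _ = _ := by rw [← pow_add, ← pow_mul, ← pow_add]; congr 2; ring
    have e2 : (2 * w + 1) * (16 * (589825 * w)) = 18874400 * q + 9437200 * w := by
      rw [hq]; ring
    have e3 := pow_le_two_pow_neg
      ((w + 1) + (2 * w + 1) * (16 * (589825 * w)) + w) n (by rw [e2]; omega)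
    calc _ ≤ (2 : ℝ) ^ ((w + 1) + (2 * w + 1) * (16 * (589825 * w))) *
          (1 / 2) ^ ((w + 1) + (2 * w + 1) * (16 * (589825 * w)) + w) := by gcongr
      _ = (1 / 2) ^ w := by
          rw [pow_add (1 / 2 : ℝ), ← mul_assoc, ← mul_pow]
          norm_num
  have hfar : (n : ℝ) ^ (16 * (589825 * w)) * ((4 / ((64 : ℕ) : ℝ)) ^ (8 * h) *
      ((p : ℝ) ^ 8 * ((p : ℝ) ^ (655360 * (w + 1)) + 2 ^ h) ^ 8)) ≤ (1 / 2) ^ w := by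
    have e1 : (p : ℝ) ^ (655360 * (w + 1)) ≤ 2 ^ h := by
      have e : (w + 1) * (655360 * (w + 1)) = 655360 * q + 1310720 * w + 655360 := by
        rw [hq]; ring
      calc (p : ℝ) ^ (655360 * (w + 1)) ≤ (2 ^ (w + 1)) ^ (655360 * (w + 1)) := by gcongr
        _ = 2 ^ ((w + 1) * (655360 * (w + 1))) := by rw [← pow_mul]
        _ ≤ 2 ^ h := pow_le_pow_right₀ (by norm_num) (by rw [e]; omega)
    have e2 : (4 / ((64 : ℕ) : ℝ)) ^ (8 * h) = (1 / 2) ^ (32 * h) := by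
      have : (4 / ((64 : ℕ) : ℝ)) = (1 / 2) ^ 4 := by norm_num
      rw [this, ← pow_mul]
      congr 1
      ring
    have e3 : w * (16 * (589825 * w)) = 9437200 * q := by rw [hq]; ring
    rw [e2]
    calc (n : ℝ) ^ (16 * (589825 * w)) * ((1 / 2) ^ (32 * h) *
          ((p : ℝ) ^ 8 * ((p : ℝ) ^ (655360 * (w + 1)) + 2 ^ h) ^ 8))
        ≤ (2 ^ w) ^ (16 * (589825 * w)) * ((1 / 2) ^ (32 * h) *
          ((2 ^ (w + 1)) ^ 8 * (2 ^ h + 2 ^ h) ^ 8)) := by gcongr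
      _ = 2 ^ (w * (16 * (589825 * w)) + 8 * (w + 1) + 8 * (h + 1)) * (1 / 2) ^ (32 * h) := by
          rw [← two_mul, ← pow_succ', ← pow_mul, ← pow_mul, ← pow_mul]
          ring
      _ ≤ 2 ^ (32 * h - w) * (1 / 2) ^ (32 * h) := by
          have hle : w * (16 * (589825 * w)) + 8 * (w + 1) + 8 * (h + 1) ≤ 32 * h - w := by
            rw [e3]
            omega
          gcongr
          norm_num
      _ = (1 / 2) ^ w := by
          have e4 : 32 * h = (32 * h - w) + w := by omega
          have e5 : (1 / 2 : ℝ) ^ (32 * h) = (1 / 2) ^ (32 * h - w) * (1 / 2) ^ w := by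
            rw [← pow_add, ← e4]
          rw [e5, ← mul_assoc, ← mul_pow]
          norm_num
  refine hsing.trans ?_
  have htot := add_le_add hρ (hsum.trans (add_le_add hnear hfar))
  calc _ ≤ (n : ℝ) * (4 * (1 / 2) ^ w + ((1 / 2) ^ w + (1 / 2) ^ w))
        * (n.choose (n / 2) : ℝ) ^ n := by gcongr
    _ = _ := by ring

end Parameters

/-! ### Real matrices -/

section RealMatrices

theorem indicatorMatrix_injective {n : ℕ} :
    Function.Injective (indicatorMatrix (n := n) ℝ) := by
  intro R R' h
  funext i
  ext j
  have h1 := congrFun (congrFun h i) j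
  simp only [indicatorMatrix, Matrix.of_apply] at h1
  by_cases hj : j ∈ R i <;> by_cases hj' : j ∈ R' i <;> simp_all

theorem det_indicatorMatrix_zmod {n : ℕ} (p : ℕ) (R : Fin n → Finset (Fin n))
    (h : (indicatorMatrix ℝ R).det = 0) : (indicatorMatrix (ZMod p) R).det = 0 := by
  have hmap : ∀ (K : Type) [CommRing K],
      ((indicatorMatrix ℤ R).det : K) = (indicatorMatrix K R).det := by
    intro K _
    have h1 := (Int.castRingHom K).map_det (indicatorMatrix ℤ R)
    rw [eq_intCast] at h1
    rw [h1]
    congr 1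
    ext i j
    simp only [indicatorMatrix, RingHom.mapMatrix_apply, Matrix.map_apply, Matrix.of_apply]
    split_ifs <;> simp
  have h0 : (indicatorMatrix ℤ R).det = 0 := by
    rw [← hmap ℝ] at h
    exact_mod_cast h
  rw [← hmap, h0, Int.cast_zero]

open scoped Classical in
theorem rowRegularMatrices_eq {n : ℕ} (hn : Even n) :
    rowRegularMatrices n = ((rowConfigs n).image (indicatorMatrix ℝ) : Finset _) := by
  obtain ⟨m, rfl⟩ := hn
  have hhalf : (m + m) / 2 = m := by omega
  ext M
  simp only [rowRegularMatrices, Set.mem_ofPred_eq, Finset.coe_image, Set.mem_image,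
    Finset.mem_coe, rowConfigs, Fintype.mem_piFinset, Finset.mem_powersetCard_univ, hhalf]
  constructor
  · rintro ⟨h01, hsum⟩
    have hM : indicatorMatrix ℝ (fun i => Finset.univ.filter fun j => M i j = 1) = M := by
      ext i j
      simp only [indicatorMatrix, Matrix.of_apply, Finset.mem_filter, Finset.mem_univ, true_and]
      rcases h01 i j with h | h <;> simp [h]
    refine ⟨fun i => Finset.univ.filter fun j => M i j = 1, fun i => ?_, hM⟩
    have h1 : ∑ j, M i j = ((Finset.univ.filter fun j => M i j = 1).card : ℝ) := by
      rw [← Finset.sum_boole]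
      refine Finset.sum_congr rfl fun j _ => ?_
      rcases h01 i j with h | h <;> simp [h]
    rw [hsum i] at h1
    have h2 : ((Finset.univ.filter fun j => M i j = 1).card : ℝ) = m := by
      rw [← h1]
      push_cast
      ring
    exact_mod_cast h2
  · rintro ⟨R, hR, rfl⟩
    refine ⟨fun i j => ?_, fun i => ?_⟩
    · simp only [indicatorMatrix, Matrix.of_apply]
      split_ifs
      · exact Or.inr rfl
      · exact Or.inl rfl
    · simp only [indicatorMatrix, Matrix.of_apply]
      rw [Finset.sum_boole, Finset.filter_mem_eq_inter, Finset.univ_inter, hR]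
      push_cast
      ring

theorem uniformOn_singular_le {n : ℕ} (hn : Even n) (p : ℕ) (ε : ℝ)
    (hε : (((rowConfigs n).filter fun R => (indicatorMatrix (ZMod p) R).det = 0).card : ℝ)
      ≤ ε * (n.choose (n / 2) : ℝ) ^ n) :
    (ProbabilityTheory.uniformOn (rowRegularMatrices n)).real
      {M : Matrix (Fin n) (Fin n) ℝ | ¬ IsUnit M} ≤ ε := by
  classical
  set S := (rowConfigs n).image (indicatorMatrix ℝ) with hS
  set B := ((rowConfigs n).filter fun R => (indicatorMatrix (ZMod p) R).det = 0).image
    (indicatorMatrix ℝ) with hB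
  have hScard : S.card = n.choose (n / 2) ^ n := by
    rw [hS, Finset.card_image_of_injective _ indicatorMatrix_injective, card_rowConfigs]
  have hpos : (0 : ℝ) < (n.choose (n / 2) : ℝ) ^ n := pow_pos (choose_half_pos n) n
  rw [rowRegularMatrices_eq hn, ← hS, ProbabilityTheory.uniformOn, MeasureTheory.measureReal_def,
    ProbabilityTheory.cond_apply S.finite_toSet.measurableSet, ENNReal.toReal_mul,
    ENNReal.toReal_inv, MeasureTheory.Measure.count_apply_finset, hScard]
  have hsub : (S : Set (Matrix (Fin n) (Fin n) ℝ)) ∩ {M | ¬ IsUnit M} ⊆ (B : Set _) := by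
    rintro M ⟨hM, hsing⟩
    obtain ⟨R, hR, rfl⟩ := Finset.mem_image.1 (Finset.mem_coe.1 hM)
    refine Finset.mem_coe.2 (Finset.mem_image_of_mem _ (Finset.mem_filter.2 ⟨hR, ?_⟩))
    refine det_indicatorMatrix_zmod p R ?_
    by_contra hdet
    exact hsing ((Matrix.isUnit_iff_isUnit_det _).2 (isUnit_iff_ne_zero.2 hdet))
  have hle : (MeasureTheory.Measure.count
      ((S : Set (Matrix (Fin n) (Fin n) ℝ)) ∩ {M | ¬ IsUnit M})).toReal ≤ B.card := by
    have h1 := MeasureTheory.measure_mono (μ := MeasureTheory.Measure.count) hsub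
    rw [MeasureTheory.Measure.count_apply_finset] at h1
    have h2 := ENNReal.toReal_mono (ENNReal.natCast_ne_top _) h1
    rwa [ENNReal.toReal_natCast] at h2
  have hBcard : (B.card : ℝ) ≤ ε * (n.choose (n / 2) : ℝ) ^ n :=
    le_trans (by exact_mod_cast Finset.card_image_le) hε
  rw [ENNReal.toReal_natCast, Nat.cast_pow, inv_mul_le_iff₀ hpos, mul_comm]
  exact hle.trans hBcard

end RealMatrices

theorem theorem1p10 :
    ∃ c : ℝ, 0 < c ∧ ∃ N : ℕ, ∀ n : ℕ, N ≤ n → Even n →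
      (ProbabilityTheory.uniformOn (rowRegularMatrices n)).real
          {M : Matrix (Fin n) (Fin n) ℝ | ¬ IsUnit M}
        ≤ Real.exp (-((n : ℝ) ^ c)) := by
  refine ⟨1 / 8, by norm_num, (10 ^ 7) ^ 4, fun n hN hne => ?_⟩
  set w := Nat.sqrt (Nat.sqrt n) with hw
  have hw7 : 10 ^ 7 ≤ w := by
    rw [hw, Nat.le_sqrt', Nat.le_sqrt', ← pow_mul]
    exact hN
  have hwn : w ^ 4 ≤ n := by
    have h1 : w ^ 2 ≤ Nat.sqrt n := Nat.sqrt_le' _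
    have h2 : Nat.sqrt n ^ 2 ≤ n := Nat.sqrt_le' _
    calc w ^ 4 = (w ^ 2) ^ 2 := by ring
      _ ≤ Nat.sqrt n ^ 2 := Nat.pow_le_pow_left h1 2
      _ ≤ n := h2
  have hnw : n ≤ (w + 1) ^ 4 := by
    have h1 : Nat.sqrt n + 1 ≤ (w + 1) ^ 2 := Nat.succ_le_succ_sqrt' _
    have h2 : n + 1 ≤ (Nat.sqrt n + 1) ^ 2 := Nat.succ_le_succ_sqrt' _
    calc n ≤ (Nat.sqrt n + 1) ^ 2 := by omega
      _ ≤ ((w + 1) ^ 2) ^ 2 := Nat.pow_le_pow_left h1 2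
      _ = (w + 1) ^ 4 := by ring
  have hnw' : (n : ℝ) ≤ ((w : ℝ) + 1) ^ 4 := by exact_mod_cast hnw
  have hw7' : (10 : ℝ) ^ 7 ≤ w := by exact_mod_cast hw7
  have hexp := six_mul_pow_le_exp w hw7
  have htwo := exp_le_two_pow w
  have hn2 : n ≤ 2 ^ w := by
    have h1 : Real.exp (2 / 5 * w) ≤ Real.exp (13 / 20 * w) :=
      Real.exp_le_exp.2 (by linarith)
    have h2 : (n : ℝ) ≤ 2 ^ w := by
      have : 0 ≤ ((w : ℝ) + 1) ^ 4 := by positivity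
      linarith
    exact_mod_cast h2
  obtain ⟨p, hp, hp1, hp2⟩ := Nat.exists_prime_lt_and_le_two_mul (2 ^ w) (by positivity)
  have : Fact p.Prime := ⟨hp⟩
  have hbound := card_singular_le_of_fourth_root (p := p) hne hw7 hwn hn2 hp1
    (by rw [pow_succ']; exact hp2)
  refine (uniformOn_singular_le hne p _ hbound).trans ?_
  have hroot : (n : ℝ) ^ (1 / 8 : ℝ) ≤ w / 4 := by
    have h0 : (n : ℝ) ≤ ((w : ℝ) / 4) ^ (8 : ℕ) := by
      refine hnw'.trans ?_
      have h1 : (w : ℝ) + 1 ≤ (w / 4) ^ 2 := by nlinarith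
      calc ((w : ℝ) + 1) ^ 4 ≤ ((w / 4) ^ 2) ^ 4 := by gcongr
        _ = _ := by ring
    calc (n : ℝ) ^ (1 / 8 : ℝ) ≤ (((w : ℝ) / 4) ^ (8 : ℕ)) ^ (1 / 8 : ℝ) :=
          Real.rpow_le_rpow (by positivity) h0 (by norm_num)
      _ = w / 4 := by
          rw [← Real.rpow_natCast, ← Real.rpow_mul (by positivity)]
          norm_num
  calc 6 * (n : ℝ) * (1 / 2) ^ w ≤ Real.exp (2 / 5 * w) * Real.exp (-(13 / 20 * w)) := by
        have h1 : 6 * (n : ℝ) ≤ Real.exp (2 / 5 * w) := by linarith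
        have h2 : (1 / 2 : ℝ) ^ w ≤ Real.exp (-(13 / 20 * w)) := by
          rw [one_div_pow, Real.exp_neg, ← one_div]
          exact one_div_le_one_div_of_le (Real.exp_pos _) htwo
        gcongr
    _ = Real.exp (-(w / 4)) := by
        rw [← Real.exp_add]
        congr 1
        ring
    _ ≤ Real.exp (-((n : ℝ) ^ (1 / 8 : ℝ))) := by
        gcongr
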